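/- Let $G$ be a compact connected Lie group with Lie algebra $\mathfrak g$, and fix an $\mathrm{Ad}$-invariant inner product on $\mathfrak g$. Consider triples $(M,E,\phi)$, where $M$ is a smooth effective orbifold (Hausdorff, second countable, possibly noncompact, possibly with boundary) with a smooth $G$-action and a $G$-equivariant stable complex structure (represented by a smooth $G$-invariant complex structure on $TM\oplus\mathbb R^k$ for some $k\ge 0$ and some continuous linear action of $G$ on $\mathbb R^k$), $E$ is a $G$-equivariant complex orbifold vector bundle on $M$, and $\phi:M\to\mathfrak g$ is a smooth $G$-equivariant map. Let $$V^\phi(m)=\tfrac{d}{dt}\big|_{t=0}\exp(-t\phi(m))\cdot m,\qquad M^\phi=\{m\in M: V^\phi(m)=0\}.$$ The triple is a *$K$-chain* if (i) the restriction $\phi|_{M^\phi}:M^\phi\to\mathfrak g$ is a proper map, and (ii) $\phi$ is compatible with $E$: for some $G$-invariant Hermitian metric on $E$ and some constant $K$, $$\Big\|\tfrac{\sqrt{-1}}{2\pi}L_\xi+\langle\phi(m),\xi\rangle\,\mathrm{Id}_{E_m}\Big\|\le K\|\xi\|$$ for all $m\in M^\phi$ and all $\xi$ in the isotropy Lie algebra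 $\mathfrak g_m$, where $L_\xi=\frac{d}{dt}\big|_{t=0}\exp(t\xi)$ on $E_m$. It is a *$K$-cycle* if moreover $\partial M=\emptyset$. Two $K$-cycles $C$ and $D$ are *bordant* if there is a $K$-chain $(W,L,\psi)$, with $W$ not necessarily compact, whose boundary is the disjoint union of $C$ and $-D$: the space $\partial W$ is identified $G$-equivariantly with the disjoint union of the underlying orbifolds of $C$ and $D$, compatibly with the bundles and with the maps to $\mathfrak g$, and the stable complex structure of $\partial W$, defined by $TW|_{\partial W}=T\partial W\oplus\mathbb R$ with the outward normal, is equivalent to that of $C$ on the first part and to the opposite of that of $D$ on the second. (Two stable complex structures are equivalent if, after adding trivial bundles $\mathbb C^{r}$ and $\mathbb C^{r'}$ with trivial $G$-action, they become isomorphic as $G$-equivariant complex vector bundles, by an isomorphism that preserves the orientation.) Let $(M,E,\phi)$ be a $K$-cycle. 1. (Localization.) Let $\{U_\alpha\}$ be a family of pairwise disjoint $G$-invariant open subsets of $M$ with $M^\phi\subseteq\bigcup_\alpha U_\alpha$. Then each $(U_\alpha,E|_{U_\alpha},\phi|_{U_\alpha})$ and their disjoint union $\bigsqcup_\alpha(U_\alpha,E|_{U_\alpha},\phi|_{U_\alpha})$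 are $K$-cycles, and $(M,E,\phi)$ is bordant to this disjoint union. 2. (Gluing.) Let $\Sigma\subset M$ be a smooth $G$-invariant hypersurface such that $M\setminus\Sigma=M_+\sqcup M_-$ with $M_+$ and $M_-$ open and disjoint, and suppose that $V^\phi$ vanishes nowhere on $\Sigma$. Then $M_\pm$ are $G$-invariant, $(M_+,E|_{M_+},\phi|_{M_+})$, $(M_-,E|_{M_-},\phi|_{M_-})$ and their sum (disjoint union) are $K$-cycles, and $(M,E,\phi)$ is bordant to the sum $(M_+,E|_{M_+},\phi|_{M_+})+(M_-,E|_{M_-},\phi|_{M_-})$. In particular, the two sides represent the same class for every equivalence relation on $K$-cycles that contains bordism, such as the one generated by bordism, direct sum of bundles and bundle modification. -/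

import Mathlib

open Set Filter Topology
open scoped Manifold ContDiff ComplexOrder

noncomputable section

/-- The adjoint action of `g` on the Lie algebra: the derivative at `1` of conjugation by `g`. -/
def adjointAction {d : ℕ} {G : Type*} [Group G] [TopologicalSpace G]
    [ChartedSpace (EuclideanSpace ℝ (Fin d)) G] (g : G) (ξ : GroupLieAlgebra (𝓡 d) G) :
    GroupLieAlgebra (𝓡 d) G :=
  (mfderiv (𝓡 d) (𝓡 d) (fun h : G => g * h * g⁻¹) 1 : _) ξ

/-- An inner product on the Lie algebra that is invariant under the adjoint action. -/
structure IsInvariantInner {d : ℕ} {G : Type*} [Group G] [TopologicalSpace G]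
    [ChartedSpace (EuclideanSpace ℝ (Fin d)) G]
    (B : GroupLieAlgebra (𝓡 d) G →ₗ[ℝ] GroupLieAlgebra (𝓡 d) G →ₗ[ℝ] ℝ) : Prop where
  symm : ∀ ξ η, B ξ η = B η ξ
  pos : ∀ ξ, ξ ≠ 0 → 0 < B ξ ξ
  inv : ∀ (g : G) (ξ η), B (adjointAction g ξ) (adjointAction g η) = B ξ η

/-- The data of a triple `(M, E, φ)`: the underlying space `X` of an orbifold `M`, possibly with
boundary, with an action of `G`; orbifold charts; the total space `E` of a complex orbifold vector
bundle with projection `p` and trivializations over the charts; a complex structure `J` on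
`TM ⊕ ℝᵏ`, given in the charts; and a map `φ` to the Lie algebra. The group `G` acts on the summand
`ℝᵏ` through `ρ`. All smoothness, compatibility and equivariance requirements are in
`GTriple.IsOrbifold`, `GTriple.IsBundle`, `GTriple.IsStableComplex` and `GTriple.IsEquivariantMap`.

The `i`-th chart is the map `π i : dom i → X`, where `dom i` is a relatively open subset of the
half space `{x | 0 ≤ ℓ i x}` of the vector space `V i` (all of `V i` if `ℓ i = 0`). Over it, the
bundle is presented by `triv i : dom i × ℂʳ → E`. -/
structure GTriple {d : ℕ} (G : Type*) [Group G] [TopologicalSpace G]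
    [ChartedSpace (EuclideanSpace ℝ (Fin d)) G] (k : ℕ)
    (ρ : G →* ((Fin k → ℝ) →L[ℝ] (Fin k → ℝ))) where
  X : Type
  [topX : TopologicalSpace X]
  [actX : MulAction G X]
  ι : Type
  V : ι → Type
  [normV : ∀ i, NormedAddCommGroup (V i)]
  [spaceV : ∀ i, NormedSpace ℝ (V i)]
  [finV : ∀ i, FiniteDimensional ℝ (V i)]
  ℓ : ∀ i, V i →L[ℝ] ℝ
  dom : ∀ i, Set (V i)
  π : ∀ i, dom i → X
  E : Type
  [actE : MulAction G E]
  p : E → X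
  p_smul : ∀ (g : G) (e : E), p (g • e) = g • p e
  rk : ι → ℕ
  triv : ∀ i, dom i → (Fin (rk i) → ℂ) → E
  p_triv : ∀ i x v, p (triv i x v) = π i x
  J : ∀ i, V i → ((V i × (Fin k → ℝ)) →L[ℝ] (V i × (Fin k → ℝ)))
  φ : X → GroupLieAlgebra (𝓡 d) G

attribute [instance] GTriple.topX GTriple.actX GTriple.normV GTriple.spaceV GTriple.finV
  GTriple.actE

/-- `ℂʳ` with its coordinates. -/
abbrev CVec (r : ℕ) : Type := Fin r → ℂ

namespace GTriple

section Basic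

variable {d : ℕ} {G : Type*} [Group G] [TopologicalSpace G]
  [ChartedSpace (EuclideanSpace ℝ (Fin d)) G] {k : ℕ}
  {ρ : G →* ((Fin k → ℝ) →L[ℝ] (Fin k → ℝ))} (C : GTriple (d := d) G k ρ)

/-- The boundary of the orbifold: the points that lie over the bounding hyperplane of a chart. -/
def boundary : Set C.X :=
  {m | ∃ i, ∃ x : C.dom i, C.ℓ i ≠ 0 ∧ C.ℓ i x = 0 ∧ C.π i x = m}

/-- The derivative at `x` of the map `a g`, in the charts `i` and `j`. -/
def tangentMap {i j : C.ι} (a : G → C.V i → C.V j) (g : G) (x : C.V i) : C.V i →L[ℝ] C.V j :=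
  fderivWithin ℝ (a g) (C.dom i) x

/-- Near `(g₀, x₀)`, the map `a` is a smooth lift of the action `(g, m) ↦ g • m` to the charts
`i` and `j`, and a local diffeomorphism for fixed `g`. -/
def IsLocalLift (g₀ : G) (i j : C.ι) (x₀ : C.V i) (a : G → C.V i → C.V j) : Prop :=
  x₀ ∈ C.dom i ∧ ∀ᶠ q : G × C.V i in 𝓝 g₀ ×ˢ 𝓝[C.dom i] x₀,
    (∃ (hx : q.2 ∈ C.dom i) (hy : a q.1 q.2 ∈ C.dom j),
      C.π j ⟨a q.1 q.2, hy⟩ = q.1 • C.π i ⟨q.2, hx⟩) ∧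
    ContMDiffWithinAt ((𝓡 d).prod 𝓘(ℝ, C.V i)) 𝓘(ℝ, C.V j) ∞
      (fun q : G × C.V i => a q.1 q.2) (univ ×ˢ C.dom i) q ∧
    Function.Bijective (C.tangentMap a q.1 q.2)

/-- `X` is a smooth orbifold, possibly with boundary, with a smooth action of `G`: Hausdorff, second
countable, covered by the charts; each chart is the quotient of `dom i` by a finite group of
diffeomorphisms, onto an open subset of `X`; and the action of `G` lifts locally to smooth maps
between charts (for `g₀ = 1` this is the compatibility of the charts). -/
structure IsOrbifold : Prop where
  t2 : T2Space C.X
  secondCountable : SecondCountableTopology C.X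
  dom_open : ∀ i, ∃ O : Set (C.V i), IsOpen O ∧ C.dom i = O ∩ {x | 0 ≤ C.ℓ i x}
  cover : ∀ m, ∃ i, ∃ x : C.dom i, C.π i x = m
  continuous : ∀ i, Continuous (C.π i)
  openMap : ∀ i, IsOpenMap (C.π i)
  quotient : ∀ i, ∃ Γ : Subgroup (Equiv.Perm (C.dom i)), Finite Γ ∧
    (∀ γ ∈ Γ, ∃ f : C.V i → C.V i, ContDiffOn ℝ ∞ f (C.dom i) ∧ ∀ x : C.dom i, f x = γ x) ∧
    ∀ x y, C.π i x = C.π i y ↔ ∃ γ ∈ Γ, γ x = y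
  lift : ∀ (g₀ : G) (i j : C.ι) (x : C.dom i) (y : C.dom j), g₀ • C.π i x = C.π j y →
    ∃ a, C.IsLocalLift g₀ i j x a ∧ a g₀ x = y

/-- Near `(g₀, x₀)`, the pair `(a, A)` is a smooth lift to the charts of the action of `G` on the
bundle; `A` consists of the linear isomorphisms of the fibres. -/
def IsBundleLift (g₀ : G) (i j : C.ι) (x₀ : C.V i) (a : G → C.V i → C.V j)
    (A : G → C.V i → (CVec (C.rk i) →L[ℂ] CVec (C.rk j))) : Prop :=
  C.IsLocalLift g₀ i j x₀ a ∧ ∀ᶠ q : G × C.V i in 𝓝 g₀ ×ˢ 𝓝[C.dom i] x₀,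
    (∃ (hx : q.2 ∈ C.dom i) (hy : a q.1 q.2 ∈ C.dom j), ∀ v,
      C.triv j ⟨a q.1 q.2, hy⟩ (A q.1 q.2 v) = q.1 • C.triv i ⟨q.2, hx⟩ v) ∧
    ContMDiffWithinAt ((𝓡 d).prod 𝓘(ℝ, C.V i))
      𝓘(ℝ, CVec (C.rk i) →L[ℂ] CVec (C.rk j)) ∞
      (fun q : G × C.V i => A q.1 q.2) (univ ×ˢ C.dom i) q ∧
    Function.Bijective (A q.1 q.2)

/-- `p : E → X` is a `G`-equivariant complex orbifold vector bundle: `triv i` maps `{x} × ℂʳ` onto the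
fibre over `π i x`; the action of `G` on `X` (and in particular the changes of charts) lifts to
smooth linear isomorphisms of the fibres; two vectors over `x` are the same point of `E` only
if they are related by the local group of `x`; and the identity of a chart only has the
identity as a lift. (The topology of `E` is the quotient topology of the trivializations.) -/
structure IsBundle : Prop where
  surj : ∀ (e : C.E) (i : C.ι) (x : C.dom i), C.π i x = C.p e → ∃ v, C.triv i x v = e
  lift : ∀ (g₀ : G) (i j : C.ι) (x : C.V i) (a), C.IsLocalLift g₀ i j x a →
    ∃ A, C.IsBundleLift g₀ i j x a A
  fibre : ∀ (i : C.ι) (x : C.dom i) (v w), C.triv i x v = C.triv i x w →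
    ∃ a A, C.IsBundleLift 1 i i x a A ∧ a 1 x = x ∧ A 1 x v = w
  unique : ∀ (i : C.ι) (x : C.V i) (a A), C.IsBundleLift 1 i i x a A →
    (∀ᶠ x' in 𝓝[C.dom i] x, a 1 x' = x') → A 1 x = ContinuousLinearMap.id ℂ _

/-- `J` is a smooth `G`-invariant complex structure on the orbifold vector bundle `TX ⊕ ℝᵏ`, where
`G` acts on `ℝᵏ` by `ρ`. -/
structure IsStableComplex : Prop where
  cont : Continuous ρ
  smooth : ∀ i, ContDiffOn ℝ ∞ (C.J i) (C.dom i)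
  sq : ∀ i, ∀ x ∈ C.dom i, ∀ z, C.J i x (C.J i x z) = -z
  inv : ∀ (g₀ : G) (i j : C.ι) (x : C.V i) (a), C.IsLocalLift g₀ i j x a → ∀ z,
    ((C.tangentMap a g₀ x).prodMap (ρ g₀)) (C.J i x z) =
      C.J j (a g₀ x) (((C.tangentMap a g₀ x).prodMap (ρ g₀)) z)

/-- `φ` is a smooth `G`-equivariant map to the Lie algebra. -/
structure IsEquivariantMap : Prop where
  equivariant : ∀ (g : G) (m : C.X), C.φ (g • m) = adjointAction g (C.φ m)
  smooth : ∀ i, ∃ f : C.V i → EuclideanSpace ℝ (Fin d), ContDiffOn ℝ ∞ f (C.dom i) ∧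
    ∀ x : C.dom i, f x = C.φ (C.π i x)

/-- The derivative at `t = 0` of `a (exp (t ξ)) x`, that is, the derivative at `1` of the orbit
map `g ↦ a g x`, applied to `ξ`. -/
def infinitesimal {i : C.ι} (a : G → C.V i → C.V i) (x : C.V i)
    (ξ : GroupLieAlgebra (𝓡 d) G) : C.V i :=
  (mfderiv (𝓡 d) 𝓘(ℝ, C.V i) (fun g : G => a g x) 1 : _) ξ

/-- The derivative at `t = 0` of `A (exp (t ξ)) x`. For `ξ` in the isotropy Lie algebra of the point
under `x`, this is the Lie derivative `L_ξ` on the fibre. -/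
def lieDerivative {i : C.ι} (A : G → C.V i → (CVec (C.rk i) →L[ℂ] CVec (C.rk i))) (x : C.V i)
    (ξ : GroupLieAlgebra (𝓡 d) G) : CVec (C.rk i) →L[ℂ] CVec (C.rk i) :=
  (mfderiv (𝓡 d) 𝓘(ℝ, CVec (C.rk i) →L[ℂ] CVec (C.rk i)) (fun g : G => A g x) 1 : _) ξ

/-- The set of zeros of the vector field `V^φ(m) = d/dt|₀ exp(-t φ(m)) • m`, computed in charts. -/
def vanishingSet : Set C.X :=
  {m | ∀ (i : C.ι) (x : C.dom i) (a : G → C.V i → C.V i), C.π i x = m →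
    C.IsLocalLift 1 i i x a → a 1 x = x → C.infinitesimal a x (-(C.φ m)) = 0}

/-- A smooth `G`-invariant Hermitian metric on `E`; in the chart `i` it is `⟨v, w⟩ = v* (h i x) w`. -/
structure IsHermitianMetric
    (h : ∀ i, C.V i → Matrix (Fin (C.rk i)) (Fin (C.rk i)) ℂ) : Prop where
  smooth : ∀ i (s t), ContDiffOn ℝ ∞ (fun x => h i x s t) (C.dom i)
  pos : ∀ i, ∀ x ∈ C.dom i, (h i x).PosDef
  inv : ∀ (g₀ : G) (i j : C.ι) (x : C.V i) (a A), C.IsBundleLift g₀ i j x a A → ∀ v w,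
    dotProduct (star (A g₀ x v)) ((h j (a g₀ x)).mulVec (A g₀ x w)) =
      dotProduct (star v) ((h i x).mulVec w)

/-- The norm of a vector with respect to the positive definite matrix `h`. -/
def hermNorm {r : ℕ} (h : Matrix (Fin r) (Fin r) ℂ) (v : CVec r) : ℝ :=
  Real.sqrt (dotProduct (star v) (h.mulVec v)).re

/-- `φ` is compatible with `E`: for an invariant Hermitian metric and a constant `K`, one has
`‖(√-1 / 2π) L_ξ + ⟨φ(m), ξ⟩‖ ≤ K ‖ξ‖` on the fibre over each point `m` of the vanishing set, for
each `ξ` in the isotropy Lie algebra of `m`. -/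
def IsCompatible
    (B : GroupLieAlgebra (𝓡 d) G →ₗ[ℝ] GroupLieAlgebra (𝓡 d) G →ₗ[ℝ] ℝ) : Prop :=
  ∃ h, C.IsHermitianMetric h ∧ ∃ K : ℝ,
    ∀ (i : C.ι) (x : C.dom i), C.π i x ∈ C.vanishingSet →
    ∀ a A, C.IsBundleLift 1 i i x a A → a 1 x = x → A 1 x = ContinuousLinearMap.id ℂ _ →
    ∀ ξ, C.infinitesimal a x ξ = 0 → ∀ v,
      hermNorm (h i x) ((Complex.I / (2 * Real.pi)) • C.lieDerivative A x ξ v +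
        ((B (C.φ (C.π i x)) ξ : ℝ) : ℂ) • v) ≤
      K * Real.sqrt (B ξ ξ) * hermNorm (h i x) v

/-- `K`-chains: `φ` is compatible with `E`, and the restriction of `φ` to the vanishing set is
a proper map. -/
structure IsKChain
    (B : GroupLieAlgebra (𝓡 d) G →ₗ[ℝ] GroupLieAlgebra (𝓡 d) G →ₗ[ℝ] ℝ) : Prop where
  orbifold : C.IsOrbifold
  bundle : C.IsBundle
  stableComplex : C.IsStableComplex
  equivariantMap : C.IsEquivariantMap
  proper : IsProperMap (fun m : C.vanishingSet => C.φ m)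
  compatible : C.IsCompatible B

/-- `K`-cycles: `K`-chains without boundary. -/
structure IsKCycle
    (B : GroupLieAlgebra (𝓡 d) G →ₗ[ℝ] GroupLieAlgebra (𝓡 d) G →ₗ[ℝ] ℝ) : Prop where
  chain : C.IsKChain B
  boundaryless : C.boundary = ∅

/-- `U` is a `G`-invariant subset. -/
def IsInvariant (U : Set C.X) : Prop := ∀ (g : G), ∀ m ∈ U, g • m ∈ U

/-- The restriction `(U, E|_U, φ|_U)` to a `G`-invariant subset `U` (used for open `U`). -/
def restrict (U : Set C.X) (hU : C.IsInvariant U) : GTriple (d := d) G k ρ where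
  X := U
  actX :=
    { smul := fun g m => ⟨g • m.1, hU g m.1 m.2⟩
      one_smul := fun m => Subtype.ext (one_smul G m.1)
      mul_smul := fun g h m => Subtype.ext (mul_smul g h m.1) }
  ι := C.ι
  V := C.V
  ℓ := C.ℓ
  dom := fun i => {x | ∃ hx : x ∈ C.dom i, C.π i ⟨x, hx⟩ ∈ U}
  π := fun i x => ⟨C.π i ⟨x.1, x.2.1⟩, x.2.2⟩
  E := {e : C.E // C.p e ∈ U}
  actE :=
    { smul := fun g e => ⟨g • e.1, by rw [C.p_smul]; exact hU g _ e.2⟩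
      one_smul := fun e => Subtype.ext (one_smul G e.1)
      mul_smul := fun g h e => Subtype.ext (mul_smul g h e.1) }
  p := fun e => ⟨C.p e.1, e.2⟩
  p_smul := fun g e => Subtype.ext (C.p_smul g e.1)
  rk := C.rk
  triv := fun i x v => ⟨C.triv i ⟨x.1, x.2.1⟩ v, by rw [C.p_triv]; exact x.2.2⟩
  p_triv := fun i x v => Subtype.ext (C.p_triv i _ v)
  J := C.J
  φ := fun m => C.φ m.1

/-- The disjoint union of a family of triples. -/
def disjointUnion {A : Type} (D : A → GTriple (d := d) G k ρ) : GTriple (d := d) G k ρ where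
  X := Σ α, (D α).X
  actX :=
    { smul := fun g m => ⟨m.1, g • m.2⟩
      one_smul := fun m => Sigma.ext rfl (heq_of_eq (one_smul G m.2))
      mul_smul := fun g h m => Sigma.ext rfl (heq_of_eq (mul_smul g h m.2)) }
  ι := Σ α, (D α).ι
  V := fun i => (D i.1).V i.2
  ℓ := fun i => (D i.1).ℓ i.2
  dom := fun i => (D i.1).dom i.2
  π := fun i x => ⟨i.1, (D i.1).π i.2 x⟩
  E := Σ α, (D α).E
  actE :=
    { smul := fun g e => ⟨e.1, g • e.2⟩
      one_smul := fun e => Sigma.ext rfl (heq_of_eq (one_smul G e.2))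
      mul_smul := fun g h e => Sigma.ext rfl (heq_of_eq (mul_smul g h e.2)) }
  p := fun e => ⟨e.1, (D e.1).p e.2⟩
  p_smul := fun g e => Sigma.ext rfl (heq_of_eq ((D e.1).p_smul g e.2))
  rk := fun i => (D i.1).rk i.2
  triv := fun i x v => ⟨i.1, (D i.1).triv i.2 x v⟩
  p_triv := fun i x v => Sigma.ext rfl (heq_of_eq ((D i.1).p_triv i.2 x v))
  J := fun i => (D i.1).J i.2
  φ := fun m => (D m.1).φ m.2

/-- The sum (disjoint union) of two triples. -/
def add (D D' : GTriple (d := d) G k ρ) : GTriple (d := d) G k ρ :=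
  disjointUnion (fun b : Bool => match b with
    | true => D
    | false => D')

/-- `S` is a smooth hypersurface: its preimage in each chart is locally the zero set of a
smooth function whose derivative does not vanish. -/
def IsHypersurface (S : Set C.X) : Prop :=
  ∀ (i : C.ι) (x : C.dom i), C.π i x ∈ S →
    ∃ (O : Set (C.V i)) (u : C.V i → ℝ), IsOpen O ∧ (x : C.V i) ∈ O ∧
      ContDiffOn ℝ ∞ u (O ∩ C.dom i) ∧ fderivWithin ℝ u (C.dom i) x ≠ 0 ∧
      ∀ y : C.dom i, (y : C.V i) ∈ O → (C.π i y ∈ S ↔ u y = 0)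

end Basic

/-- From a map `V × ℝᵏ → V' × ℝˡ`, the map `V × ℝᵏ⁺² → V' × ℝˡ⁺²` that acts as `q` on the first
two coordinates and as the given map on the others. -/
def addPlane {V V' : Type} {k l : ℕ} (q : ℝ × ℝ → ℝ × ℝ)
    (T : V × (Fin k → ℝ) → V' × (Fin l → ℝ)) :
    V × (Fin (k + 2) → ℝ) → V' × (Fin (l + 2) → ℝ) :=
  fun z =>
    let w := T (z.1, fun s => z.2 s.succ.succ)
    (w.1, Fin.cons (q (z.2 0, z.2 1)).1 (Fin.cons (q (z.2 0, z.2 1)).2 w.2))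

/-- The sum of a map `V × ℝᵏ → V' × ℝˡ` and of `r` copies of `q : ℝ² → ℝ²`. -/
def addPlanes {V V' : Type} {k l : ℕ} (q : ℝ × ℝ → ℝ × ℝ)
    (T : V × (Fin k → ℝ) → V' × (Fin l → ℝ)) :
    ∀ r : ℕ, V × (Fin (k + 2 * r) → ℝ) → V' × (Fin (l + 2 * r) → ℝ)
  | 0 => T
  | r + 1 => addPlane q (addPlanes q T r)

/-- Multiplication by `√-1` on `ℂ = ℝ²`. -/
def quarterTurn (z : ℝ × ℝ) : ℝ × ℝ := (-z.2, z.1)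

section Bordism

variable {d : ℕ} {G : Type*} [Group G] [TopologicalSpace G]
  [ChartedSpace (EuclideanSpace ℝ (Fin d)) G] {k l : ℕ}
  {ρ : G →* ((Fin k → ℝ) →L[ℝ] (Fin k → ℝ))} {τ : G →* ((Fin l → ℝ) →L[ℝ] (Fin l → ℝ))}

/-- For a linear map `D : V → V'` and `n ∈ V'`, the map `V ⊕ ℝ ⊕ ℝˡ → V' ⊕ ℝˡ` that is `D` on `V`,
maps `1 ∈ ℝ` to `n`, and is the identity on `ℝˡ`. -/
def normalSplitting {V V' : Type} [NormedAddCommGroup V] [NormedSpace ℝ V]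
    [NormedAddCommGroup V'] [NormedSpace ℝ V'] {k l : ℕ} (hkl : k = l + 1)
    (D : V →L[ℝ] V') (n : V') (z : V × (Fin k → ℝ)) : V' × (Fin l → ℝ) :=
  (D z.1 + z.2 (Fin.cast hkl.symm 0) • n, fun s => z.2 (Fin.cast hkl.symm s.succ))

/-- `f : C.X → W.X` and `F : C.E → W.E` identify `C` with a part of the boundary of `W`, together
with its bundle, its map to the Lie algebra and its stable complex structure.

In the charts, `f` lifts to diffeomorphisms `s i` onto open parts of boundary hyperplanes and `F` to
smooth linear isomorphisms `θ i x` of the fibres. The boundary carries the stable complex structure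
given by `TW = T∂W ⊕ ℝ` (the summand `ℝ` being spanned by the outward normal), and the one of `C` is
equivalent to it (`ε = 1`) or to its opposite (`ε = -1`): after adding trivial bundles `ℂʳ`
and `ℂʳ'` there is an equivariant isomorphism `Φ` of complex vector bundles, which preserves or
reverses the orientation, according to the sign of `ε`. -/
def IsBoundaryPart (ε : ℝ) (C : GTriple (d := d) G k ρ) (W : GTriple (d := d) G l τ)
    (f : C.X → W.X) (F : C.E → W.E) : Prop :=
  (∀ (g : G) m, f (g • m) = g • f m) ∧
  (∀ m, W.φ (f m) = C.φ m) ∧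
  (∀ (g : G) e, F (g • e) = g • F e) ∧
  (∀ e, W.p (F e) = f (C.p e)) ∧
  ∃ (σ : C.ι → W.ι) (s : ∀ i, C.V i → W.V (σ i))
    (θ : ∀ i, C.V i → (CVec (C.rk i) →L[ℂ] CVec (W.rk (σ i)))),
    (∀ i, ContDiffOn ℝ ∞ (s i) (C.dom i)) ∧
    (∀ i, ContDiffOn ℝ ∞ (θ i) (C.dom i)) ∧
    (∀ i (x : C.dom i), W.ℓ (σ i) ≠ 0 ∧ W.ℓ (σ i) (s i x) = 0 ∧
      Function.Injective (fderivWithin ℝ (s i) (C.dom i) x) ∧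
      Set.range (fderivWithin ℝ (s i) (C.dom i) x) = {y | W.ℓ (σ i) y = 0} ∧
      Function.Bijective (θ i x) ∧
      ∃ hs : s i x ∈ W.dom (σ i), W.π (σ i) ⟨s i x, hs⟩ = f (C.π i x) ∧
        ∀ v, W.triv (σ i) ⟨s i x, hs⟩ (θ i x v) = F (C.triv i x v)) ∧
    ∃ (r r' : ℕ) (hr : k + 2 * r = (l + 2 * r') + 1)
      (Φ : ∀ i, C.V i → ((C.V i × (Fin (k + 2 * r) → ℝ)) →L[ℝ]
        (W.V (σ i) × (Fin (l + 2 * r') → ℝ)))),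
      (∀ i, ContDiffOn ℝ ∞ (Φ i) (C.dom i)) ∧
      (∀ i, ∀ x ∈ C.dom i, Function.Bijective (Φ i x)) ∧
      (∀ i, ∀ x ∈ C.dom i, ∀ z, Φ i x (addPlanes quarterTurn (C.J i x) r z) =
        addPlanes quarterTurn (W.J (σ i) (s i x)) r' (Φ i x z)) ∧
      (∀ (g₀ : G) (i j : C.ι) (x : C.V i) (a c), C.IsLocalLift g₀ i j x a →
        W.IsLocalLift g₀ (σ i) (σ j) (s i x) c →
        (∀ᶠ q : G × C.V i in 𝓝 g₀ ×ˢ 𝓝[C.dom i] x, c q.1 (s i q.2) = s j (a q.1 q.2)) →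
        ∀ z, Φ j (a g₀ x) (addPlanes id ((C.tangentMap a g₀ x).prodMap (ρ g₀)) r z) =
          addPlanes id ((W.tangentMap c g₀ (s i x)).prodMap (τ g₀)) r' (Φ i x z)) ∧
      (∀ i, ∀ x ∈ C.dom i, ∀ n, W.ℓ (σ i) n < 0 →
        ∃ T : (C.V i × (Fin (k + 2 * r) → ℝ)) →ₗ[ℝ] (C.V i × (Fin (k + 2 * r) → ℝ)),
          (∀ z, Φ i x z =
            normalSplitting hr (fderivWithin ℝ (s i) (C.dom i) x) n (T z)) ∧
          0 < ε * LinearMap.det T)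

/-- `C` is bordant to `D`: there is a `K`-chain `W` whose boundary is the disjoint union of `C` and
of the opposite of `D`. Here `C` and `D` are meant to be `K`-cycles; `W` need not be compact. -/
def Bordant (B : GroupLieAlgebra (𝓡 d) G →ₗ[ℝ] GroupLieAlgebra (𝓡 d) G →ₗ[ℝ] ℝ)
    (C : GTriple (d := d) G k ρ) (D : GTriple (d := d) G l τ) : Prop :=
  ∃ (n : ℕ) (υ : G →* ((Fin n → ℝ) →L[ℝ] (Fin n → ℝ))) (W : GTriple (d := d) G n υ),
    W.IsKChain B ∧ ∃ (f : C.X → W.X) (F : C.E → W.E) (f' : D.X → W.X) (F' : D.E → W.E),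
      IsBoundaryPart 1 C W f F ∧ IsBoundaryPart (-1) D W f' F' ∧
      IsEmbedding (Sum.elim f f') ∧ Set.range (Sum.elim f f') = W.boundary

end Bordism

end GTriple

end

noncomputable section


/-! ### Open suborbifolds of a triple without boundary, and the lifts over them. -/

namespace GTriple

section OpenParts

variable {d : ℕ} {G : Type*} [Group G] [TopologicalSpace G]
  [ChartedSpace (EuclideanSpace ℝ (Fin d)) G] {k : ℕ}
  {ρ : G →* ((Fin k → ℝ) →L[ℝ] (Fin k → ℝ))} {C : GTriple (d := d) G k ρ}

/-! Let U be an invariant open set containing M^φ. The bordism is the noncompact cylinder W = M ×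
[0,1] ∖ (M ∖ U) × {1}, with bundle and map pulled back from M. Its boundary is M at t = 0 and U at t
= 1. As G acts trivially on the interval, V^ψ has no t-component and its zeros lie over those of
V^φ. Since M^φ ⊆ U, no zero has been removed: W^ψ = M^φ × [0,1]. Hence ψ is proper on W^ψ by
compactness of [0,1], and compatibility with the bundle is inherited slice by slice
(`cylinder_isKChain`).

For localization, U is the disjoint union of the U_α. Each U_α ∩ M^φ is closed in M^φ, its
complement there being covered by the other U_β, so properness survives restriction
(`OpenPart.isKCycle`). Gluing is the case U = M ∖ Σ; the two sides are invariant because orbits of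
the connected group G are connected.

The technical core is the comparison of lifts in `exists_eq_of_isLocalLift_cylinder`: near a point,
every lift of the action to charts of W is a lift on M times a translation of t. The t-component is
forced by the chart maps; the M-component moves continuously in a finite fibre of an orbifold chart
and hence does not depend on t. The boundary structures are compared by
`OpenPart.isBoundaryPart_cylinder`, where a determinant shows that the two ends carry opposite
signs.

`OpenPart` treats M, its open subsets and their disjoint unions uniformly. -/

theorem IsOrbifold.isOpen_dom (hC : C.IsOrbifold) (hb : C.boundary = ∅) (i : C.ι) :
    IsOpen (C.dom i) := by
  obtain ⟨O, hO, h⟩ := hC.dom_open i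
  by_cases hl : C.ℓ i = 0
  · have : C.dom i = O := by rw [h, hl]; simp
    rw [this]; exact hO
  -- A point of the domain on the hyperplane would give a boundary point, so the closed half space
  -- may be replaced by the open one.
  · have : C.dom i = O ∩ {x | 0 < C.ℓ i x} := by
      ext x
      constructor
      · intro hx
        have hx' := hx
        rw [h] at hx'
        refine ⟨hx'.1, mem_ofPred.2 (lt_of_le_of_ne hx'.2 fun h0 => ?_)⟩
        have : C.π i ⟨x, hx⟩ ∈ C.boundary := ⟨i, ⟨x, hx⟩, hl, h0.symm, rfl⟩
        rw [hb] at this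
        exact this
      · rintro ⟨hx, hx'⟩
        rw [h]
        exact ⟨hx, mem_ofPred.2 (le_of_lt hx')⟩
    rw [this]
    exact hO.inter (isOpen_lt continuous_const (C.ℓ i).continuous)

theorem isLocalLift_iff_of_isOpen {g₀ : G} {i j : C.ι} {x₀ : C.V i} {a : G → C.V i → C.V j}
    (hi : IsOpen (C.dom i)) : C.IsLocalLift g₀ i j x₀ a ↔
    x₀ ∈ C.dom i ∧ ∀ᶠ q : G × C.V i in 𝓝 (g₀, x₀),
    (∃ (hx : q.2 ∈ C.dom i) (hy : a q.1 q.2 ∈ C.dom j),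
      C.π j ⟨a q.1 q.2, hy⟩ = q.1 • C.π i ⟨q.2, hx⟩) ∧
    ContMDiffAt ((𝓡 d).prod 𝓘(ℝ, C.V i)) 𝓘(ℝ, C.V j) ∞
      (fun q : G × C.V i => a q.1 q.2) q ∧
    Function.Bijective (fderiv ℝ (a q.1) q.2) := by
  unfold IsLocalLift
  refine and_congr_right fun hx => ?_
  rw [hi.nhdsWithin_eq hx, nhds_prod_eq]
  have : ∀ᶠ q : G × C.V i in 𝓝 g₀ ×ˢ 𝓝 x₀, q.2 ∈ C.dom i := by
    rw [← nhds_prod_eq]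
    exact continuous_snd.continuousAt.eventually (hi.mem_nhds hx)
  refine eventually_congr (this.mono fun q hq => ?_)
  have hq' : (univ : Set G) ×ˢ C.dom i ∈ 𝓝 q := (isOpen_univ.prod hi).mem_nhds ⟨trivial, hq⟩
  rw [tangentMap, fderivWithin_of_isOpen hi hq]
  refine and_congr_right fun _ => and_congr_left fun _ => ?_
  exact ⟨fun h => h.contMDiffAt hq', fun h => h.contMDiffWithinAt⟩

theorem isBundleLift_iff_of_isOpen {g₀ : G} {i j : C.ι} {x₀ : C.V i} {a : G → C.V i → C.V j}
    {A : G → C.V i → (CVec (C.rk i) →L[ℂ] CVec (C.rk j))}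
    (hi : IsOpen (C.dom i)) : C.IsBundleLift g₀ i j x₀ a A ↔
    C.IsLocalLift g₀ i j x₀ a ∧ ∀ᶠ q : G × C.V i in 𝓝 (g₀, x₀),
    (∃ (hx : q.2 ∈ C.dom i) (hy : a q.1 q.2 ∈ C.dom j), ∀ v,
      C.triv j ⟨a q.1 q.2, hy⟩ (A q.1 q.2 v) = q.1 • C.triv i ⟨q.2, hx⟩ v) ∧
    ContMDiffAt ((𝓡 d).prod 𝓘(ℝ, C.V i))
      𝓘(ℝ, CVec (C.rk i) →L[ℂ] CVec (C.rk j)) ∞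
      (fun q : G × C.V i => A q.1 q.2) q ∧
    Function.Bijective (A q.1 q.2) := by
  unfold IsBundleLift
  refine and_congr_right fun hl => ?_
  have hx := hl.1
  rw [hi.nhdsWithin_eq hx, nhds_prod_eq]
  have : ∀ᶠ q : G × C.V i in 𝓝 g₀ ×ˢ 𝓝 x₀, q.2 ∈ C.dom i := by
    rw [← nhds_prod_eq]
    exact continuous_snd.continuousAt.eventually (hi.mem_nhds hx)
  refine eventually_congr (this.mono fun q hq => ?_)
  have hq' : (univ : Set G) ×ˢ C.dom i ∈ 𝓝 q := (isOpen_univ.prod hi).mem_nhds ⟨trivial, hq⟩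
  refine and_congr_right fun _ => and_congr_left fun _ => ?_
  exact ⟨fun h => h.contMDiffAt hq', fun h => h.contMDiffWithinAt⟩

/-- An open suborbifold of a triple, with the restricted bundle. Its charts are restrictions of
charts of `C` to the preimages of open sets `region i`. -/
structure OpenPart (C : GTriple (d := d) G k ρ) where
  X : Type
  [topX : TopologicalSpace X]
  [actX : MulAction G X]
  incl : X → C.X
  isOpenEmbedding : IsOpenEmbedding incl
  incl_smul : ∀ (g : G) m, incl (g • m) = g • incl m
  E : Type
  [actE : MulAction G E]
  inclE : E → C.E
  inclE_injective : Function.Injective inclE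
  inclE_smul : ∀ (g : G) e, inclE (g • e) = g • inclE e
  p : E → X
  incl_p : ∀ e, incl (p e) = C.p (inclE e)
  ι : Type
  κ : ι → C.ι
  region : ι → Set C.X
  isOpen_region : ∀ i, IsOpen (region i)
  -- Every chart of `C` reappears near every point of the part. Conditions quantified over all
  -- charts at a point, such as the vanishing of V^φ, therefore transfer in both directions.
  exists_chart : ∀ m i, ∃ i', κ i' = i ∧ incl m ∈ region i'
  dom : ∀ i, Set (C.V (κ i))
  mem_dom : ∀ i x, x ∈ dom i ↔ ∃ hx : x ∈ C.dom (κ i), C.π (κ i) ⟨x, hx⟩ ∈ region i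
  π : ∀ i, dom i → X
  incl_π : ∀ i (x : dom i), incl (π i x) = C.π (κ i) ⟨x, ((mem_dom i x).1 x.2).1⟩
  triv : ∀ i, dom i → CVec (C.rk (κ i)) → E
  inclE_triv : ∀ i (x : dom i) v,
    inclE (triv i x v) = C.triv (κ i) ⟨x, ((mem_dom i x).1 x.2).1⟩ v

attribute [instance] OpenPart.topX OpenPart.actX OpenPart.actE

namespace OpenPart

/-- The triple defined by an open suborbifold. -/
abbrev toTriple (P : OpenPart C) : GTriple (d := d) G k ρ where
  X := P.X
  ι := P.ι
  V := fun i => C.V (P.κ i)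
  ℓ := fun i => C.ℓ (P.κ i)
  dom := P.dom
  π := P.π
  E := P.E
  p := P.p
  p_smul := fun g e => P.isOpenEmbedding.injective (by
    rw [P.incl_smul, P.incl_p, P.incl_p, P.inclE_smul, C.p_smul])
  rk := fun i => C.rk (P.κ i)
  triv := P.triv
  p_triv := fun i x v => P.isOpenEmbedding.injective (by
    rw [P.incl_p, P.inclE_triv, C.p_triv, P.incl_π])
  J := fun i => C.J (P.κ i)
  φ := fun m => C.φ (P.incl m)

variable (P : OpenPart C)

theorem dom_subset (i : P.ι) : P.dom i ⊆ C.dom (P.κ i) := fun x hx => ((P.mem_dom i x).1 hx).1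

theorem isOpen_dom (hC : C.IsOrbifold) (hb : C.boundary = ∅) (i : P.ι) : IsOpen (P.dom i) := by
  have h := ((P.isOpen_region i).preimage (hC.continuous (P.κ i)))
  have := (hC.isOpen_dom hb (P.κ i)).isOpenMap_subtype_val _ h
  convert this using 1
  ext x
  rw [P.mem_dom]
  simp

/-- The domains of the part are open and lifts are continuous, so it is enough that source and
target lie in them at the base point; nearby points follow. The equation over `P.X` is checked after
the injective map `incl`. -/
theorem isLocalLift_iff (hC : C.IsOrbifold) (hb : C.boundary = ∅) {g₀ : G} {i j : P.ι}
    {x₀ : C.V (P.κ i)} {a : G → C.V (P.κ i) → C.V (P.κ j)} :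
    P.toTriple.IsLocalLift g₀ i j x₀ a ↔
      C.IsLocalLift g₀ (P.κ i) (P.κ j) x₀ a ∧ x₀ ∈ P.dom i ∧ a g₀ x₀ ∈ P.dom j := by
  rw [isLocalLift_iff_of_isOpen (C := C) (hC.isOpen_dom hb _),
    isLocalLift_iff_of_isOpen (C := P.toTriple) (P.isOpen_dom hC hb i)]
  constructor
  · rintro ⟨hx, h⟩
    refine ⟨⟨P.dom_subset i hx, h.mono ?_⟩, hx, h.self_of_nhds.1.2.1⟩
    rintro q ⟨⟨hx, hy, h⟩, h'⟩
    refine ⟨⟨P.dom_subset i hx, P.dom_subset j hy, ?_⟩, h'⟩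
    rw [← P.incl_π j ⟨_, hy⟩, ← P.incl_π i ⟨_, hx⟩, ← P.incl_smul]
    exact congrArg P.incl h
  · rintro ⟨⟨_, h⟩, hx, hy⟩
    refine ⟨hx, ?_⟩
    have hx' : ∀ᶠ q : G × C.V (P.κ i) in 𝓝 (g₀, x₀), q.2 ∈ P.dom i :=
      continuous_snd.continuousAt.eventually ((P.isOpen_dom hC hb i).mem_nhds hx)
    have hy' : ∀ᶠ q : G × C.V (P.κ i) in 𝓝 (g₀, x₀), a q.1 q.2 ∈ P.dom j :=
      h.self_of_nhds.2.1.continuousAt.eventually ((P.isOpen_dom hC hb j).mem_nhds hy)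
    filter_upwards [h, hx', hy'] with q hq hx hy
    refine ⟨⟨hx, hy, P.isOpenEmbedding.injective ?_⟩, hq.2⟩
    obtain ⟨h1, h2, h3⟩ := hq.1
    refine (P.incl_π j ⟨_, hy⟩).trans (h3.trans ?_)
    exact (congrArg (q.1 • ·) (P.incl_π i ⟨_, hx⟩).symm).trans (P.incl_smul _ _).symm

theorem isBundleLift_iff (hC : C.IsOrbifold) (hb : C.boundary = ∅) {g₀ : G} {i j : P.ι}
    {x₀ : C.V (P.κ i)} {a : G → C.V (P.κ i) → C.V (P.κ j)}
    {A : G → C.V (P.κ i) → (CVec (C.rk (P.κ i)) →L[ℂ] CVec (C.rk (P.κ j)))} :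
    P.toTriple.IsBundleLift g₀ i j x₀ a A ↔
      C.IsBundleLift g₀ (P.κ i) (P.κ j) x₀ a A ∧ x₀ ∈ P.dom i ∧ a g₀ x₀ ∈ P.dom j := by
  rw [isBundleLift_iff_of_isOpen (C := C) (hC.isOpen_dom hb _),
    isBundleLift_iff_of_isOpen (C := P.toTriple) (P.isOpen_dom hC hb i),
    P.isLocalLift_iff hC hb]
  constructor
  · rintro ⟨⟨hl, hm⟩, h⟩
    refine ⟨⟨hl, h.mono ?_⟩, hm⟩
    rintro q ⟨⟨hx, hy, h⟩, h'⟩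
    refine ⟨⟨P.dom_subset i hx, P.dom_subset j hy, fun v => ?_⟩, h'⟩
    rw [← P.inclE_triv j ⟨_, hy⟩, ← P.inclE_triv i ⟨_, hx⟩, ← P.inclE_smul]
    exact congrArg P.inclE (h v)
  · rintro ⟨⟨hl, h⟩, hm⟩
    refine ⟨⟨hl, hm⟩, ?_⟩
    have hl' := ((isLocalLift_iff_of_isOpen (C := P.toTriple) (P.isOpen_dom hC hb i)).1
      ((P.isLocalLift_iff hC hb).2 ⟨hl, hm⟩)).2
    filter_upwards [h, hl'] with q hq hq'
    obtain ⟨hx, hy, -⟩ := hq'.1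
    refine ⟨⟨hx, hy, fun v => P.inclE_injective ?_⟩, hq.2⟩
    obtain ⟨h1, h2, h3⟩ := hq.1
    refine (P.inclE_triv j ⟨_, hy⟩ _).trans ((h3 v).trans ?_)
    exact (congrArg (q.1 • ·) (P.inclE_triv i ⟨_, hx⟩ v).symm).trans (P.inclE_smul _ _).symm

theorem tangentMap_eq (hC : C.IsOrbifold) (hb : C.boundary = ∅) {i j : P.ι}
    {x : C.V (P.κ i)} (hx : x ∈ P.dom i) (a : G → C.V (P.κ i) → C.V (P.κ j)) (g : G) :
    P.toTriple.tangentMap (i := i) (j := j) a g x =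
      C.tangentMap (i := P.κ i) (j := P.κ j) a g x := by
  unfold tangentMap
  rw [fderivWithin_of_isOpen (hC.isOpen_dom hb _) (P.dom_subset i hx)]
  exact fderivWithin_of_isOpen (P.isOpen_dom hC hb i) hx

end OpenPart

end OpenParts

end GTriple


/-! ### Open suborbifolds as K-cycles, and the three examples. -/

theorem finite_range_toPermHom (Γ β : Type*) [Group Γ] [Finite Γ] [MulAction Γ β] :
    Finite (MulAction.toPermHom Γ β).range := by
  exact Finite.of_surjective _ (MulAction.toPermHom Γ β).rangeRestrict_surjective

namespace GTriple

section OpenParts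

variable {d : ℕ} {G : Type*} [Group G] [TopologicalSpace G]
  [ChartedSpace (EuclideanSpace ℝ (Fin d)) G] {k : ℕ}
  {ρ : G →* ((Fin k → ℝ) →L[ℝ] (Fin k → ℝ))} {C : GTriple (d := d) G k ρ}
  {B : GroupLieAlgebra (𝓡 d) G →ₗ[ℝ] GroupLieAlgebra (𝓡 d) G →ₗ[ℝ] ℝ}

namespace OpenPart

variable (P : OpenPart C)

theorem continuous_π (hC : C.IsOrbifold) (i : P.ι) : Continuous (P.π i) := by
  rw [P.isOpenEmbedding.isEmbedding.continuous_iff]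
  have : P.incl ∘ P.π i = C.π (P.κ i) ∘ Set.inclusion (P.dom_subset i) :=
    funext fun x => P.incl_π i x
  rw [this]
  exact (hC.continuous _).comp (continuous_inclusion _)

theorem isOpenMap_π (hC : C.IsOrbifold) (hb : C.boundary = ∅) (i : P.ι) :
    IsOpenMap (P.π i) := by
  intro O hO
  have h1 : P.π i '' O = P.incl ⁻¹' (C.π (P.κ i) '' (Set.inclusion (P.dom_subset i) '' O)) := by
    rw [← Set.image_comp]
    have : C.π (P.κ i) ∘ Set.inclusion (P.dom_subset i) = P.incl ∘ P.π i :=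
      funext fun x => (P.incl_π i x).symm
    rw [this, Set.image_comp, Set.preimage_image_eq _ P.isOpenEmbedding.injective]
  rw [h1]
  refine (hC.openMap _ _ ?_).preimage P.isOpenEmbedding.continuous
  have h2 : IsOpenMap (Set.inclusion (P.dom_subset i)) :=
    IsOpen.isOpenMap_inclusion (P.isOpen_dom hC hb i) (P.dom_subset i)
  exact h2 O hO

theorem isOrbifold (hC : C.IsOrbifold) (hb : C.boundary = ∅) : P.toTriple.IsOrbifold where
  t2 := haveI := hC.t2; P.isOpenEmbedding.isEmbedding.t2Space
  secondCountable :=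
    haveI := hC.secondCountable; P.isOpenEmbedding.isEmbedding.secondCountableTopology
  -- The domain is already open and lies in the half space, so it is its own witness.
  dom_open := fun i => ⟨P.dom i, P.isOpen_dom hC hb i, by
    have h : ∀ x ∈ P.dom i, 0 ≤ C.ℓ (P.κ i) x := fun x hx => by
      obtain ⟨O, -, hO⟩ := hC.dom_open (P.κ i)
      have := P.dom_subset i hx
      rw [hO] at this
      exact this.2
    exact (Set.inter_eq_left.2 h).symm⟩
  cover := fun m => by
    obtain ⟨i, x, hx⟩ := hC.cover (P.incl m)
    obtain ⟨i', rfl, hi⟩ := P.exists_chart m i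
    have hx' : (x : C.V (P.κ i')) ∈ P.dom i' := (P.mem_dom i' x).2 ⟨x.2, by rw [hx]; exact hi⟩
    exact ⟨i', ⟨x, hx'⟩, P.isOpenEmbedding.injective ((P.incl_π i' _).trans hx)⟩
  continuous := P.continuous_π hC
  openMap := P.isOpenMap_π hC hb
  quotient := fun i => by
    obtain ⟨Γ, hfin, hsm, hq⟩ := hC.quotient (P.κ i)
    -- The local group preserves the fibres of the chart map, hence the preimage of the region; its
    -- image in the permutations of that preimage is the new local group.
    have hmem : ∀ (γ : Γ) (x : P.dom i),
        ((γ : Equiv.Perm (C.dom (P.κ i))) ⟨x, P.dom_subset i x.2⟩ : C.V (P.κ i)) ∈ P.dom i := by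
      intro γ x
      rw [P.mem_dom]
      refine ⟨Subtype.coe_prop _, ?_⟩
      have := (hq ⟨x, P.dom_subset i x.2⟩ _).2 ⟨γ, γ.2, rfl⟩
      rw [Subtype.coe_eta, ← this]
      exact ((P.mem_dom i x).1 x.2).2
    let _ : MulAction Γ (P.dom i) :=
      { smul := fun γ x => ⟨_, hmem γ x⟩
        one_smul := fun x => rfl
        mul_smul := fun γ γ' x => rfl }
    have hinj : Function.Injective (Set.inclusion (P.dom_subset i)) :=
      Set.inclusion_injective _
    have hs : ∀ (γ : Γ) (x : P.dom i), ((γ • x : P.dom i) : C.V (P.κ i)) =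
      (γ : Equiv.Perm (C.dom (P.κ i))) ⟨x, P.dom_subset i x.2⟩ := fun γ x => rfl
    refine ⟨(MulAction.toPermHom Γ (P.dom i)).range, finite_range_toPermHom _ _, ?_, ?_⟩
    · rintro _ ⟨γ, rfl⟩
      obtain ⟨f, hf, hf'⟩ := hsm γ γ.2
      exact ⟨f, hf.mono (P.dom_subset i), fun x => hf' ⟨x, P.dom_subset i x.2⟩⟩
    · intro x y
      have h1 : P.π i x = P.π i y ↔ C.π (P.κ i) ⟨x, P.dom_subset i x.2⟩ =
          C.π (P.κ i) ⟨y, P.dom_subset i y.2⟩ := by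
        rw [← P.incl_π, ← P.incl_π, P.isOpenEmbedding.injective.eq_iff]
      refine h1.trans ((hq _ _).trans ?_)
      constructor
      · rintro ⟨γ, hγ, h⟩
        exact ⟨_, ⟨⟨γ, hγ⟩, rfl⟩, Subtype.ext (by have h' := congrArg Subtype.val h; exact h')⟩
      · rintro ⟨_, ⟨γ, rfl⟩, h⟩
        exact ⟨γ, γ.2, Subtype.ext (by have h' := congrArg Subtype.val h; exact h')⟩
  lift := fun g₀ i j x y h => by
    have h' : g₀ • C.π (P.κ i) ⟨x, P.dom_subset i x.2⟩ =
        C.π (P.κ j) ⟨y, P.dom_subset j y.2⟩ := by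
      rw [← P.incl_π, ← P.incl_π, ← P.incl_smul]
      exact congrArg P.incl h
    obtain ⟨a, ha, hax⟩ := hC.lift g₀ _ _ _ _ h'
    refine ⟨a, (P.isLocalLift_iff hC hb).2 ⟨ha, x.2, ?_⟩, hax⟩
    rw [hax]
    exact y.2

theorem isBundle (hC : C.IsOrbifold) (hb : C.boundary = ∅) (hE : C.IsBundle) :
    P.toTriple.IsBundle where
  surj := fun e i x h => by
    have h' : C.π (P.κ i) ⟨x, P.dom_subset i x.2⟩ = C.p (P.inclE e) := by
      rw [← P.incl_π, ← P.incl_p]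
      exact congrArg P.incl h
    obtain ⟨v, hv⟩ := hE.surj _ _ _ h'
    exact ⟨v, P.inclE_injective ((P.inclE_triv i x v).trans hv)⟩
  lift := fun g₀ i j x a ha => by
    have ha' := (P.isLocalLift_iff hC hb).1 ha
    obtain ⟨A, hA⟩ := hE.lift g₀ _ _ x a ha'.1
    exact ⟨A, (P.isBundleLift_iff hC hb).2 ⟨hA, ha'.2⟩⟩
  fibre := fun i x v w h => by
    have h' : C.triv (P.κ i) ⟨x, P.dom_subset i x.2⟩ v =
        C.triv (P.κ i) ⟨x, P.dom_subset i x.2⟩ w := by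
      rw [← P.inclE_triv, ← P.inclE_triv]
      exact congrArg P.inclE h
    obtain ⟨a, A, hA, hax, hAv⟩ := hE.fibre _ _ v w h'
    refine ⟨a, A, (P.isBundleLift_iff hC hb).2 ⟨hA, x.2, ?_⟩, hax, hAv⟩
    rw [hax]
    exact x.2
  unique := fun i x a A hA h => by
    obtain ⟨hA', hx, -⟩ := (P.isBundleLift_iff hC hb).1 hA
    refine hE.unique _ x a A hA' ?_
    rw [(hC.isOpen_dom hb _).nhdsWithin_eq (P.dom_subset i hx)]
    have h' : ∀ᶠ x' in 𝓝[P.dom i] x, a 1 x' = x' := h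
    rwa [(P.isOpen_dom hC hb i).nhdsWithin_eq hx] at h'

theorem isStableComplex (hC : C.IsOrbifold) (hb : C.boundary = ∅) (hJ : C.IsStableComplex) :
    P.toTriple.IsStableComplex where
  cont := hJ.cont
  smooth := fun i => (hJ.smooth (P.κ i)).mono (P.dom_subset i)
  sq := fun i x hx z => hJ.sq _ x (P.dom_subset i hx) z
  inv := fun g₀ i j x a ha z => by
    obtain ⟨ha', hx, -⟩ := (P.isLocalLift_iff hC hb).1 ha
    rw [P.tangentMap_eq hC hb hx]
    exact hJ.inv g₀ _ _ x a ha' z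

theorem isEquivariantMap (hφ : C.IsEquivariantMap) : P.toTriple.IsEquivariantMap where
  equivariant := fun g m => by
    show C.φ (P.incl (g • m)) = _
    rw [P.incl_smul, hφ.equivariant]
  smooth := fun i => by
    obtain ⟨f, hf, h⟩ := hφ.smooth (P.κ i)
    refine ⟨f, hf.mono (P.dom_subset i), fun x => ?_⟩
    refine (h ⟨x, P.dom_subset i x.2⟩).trans ?_
    exact congrArg C.φ (P.incl_π i x).symm

theorem boundary_eq_empty (hb : C.boundary = ∅) : P.toTriple.boundary = ∅ := by
  rw [Set.eq_empty_iff_forall_notMem]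
  rintro m ⟨i, x, hl, hx, -⟩
  have : C.π (P.κ i) ⟨x, P.dom_subset i x.2⟩ ∈ C.boundary := ⟨_, _, hl, hx, rfl⟩
  rw [hb] at this
  exact this

theorem mem_vanishingSet (hC : C.IsOrbifold) (hb : C.boundary = ∅) (m : P.X) :
    m ∈ P.toTriple.vanishingSet ↔ P.incl m ∈ C.vanishingSet := by
  constructor
  · intro h i x a hx ha hax
    obtain ⟨i', rfl, hi⟩ := P.exists_chart m i
    have hx' : (x : C.V (P.κ i')) ∈ P.dom i' := (P.mem_dom i' x).2 ⟨x.2, by rw [hx]; exact hi⟩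
    refine h i' ⟨x, hx'⟩ a ?_ ((P.isLocalLift_iff hC hb).2 ⟨ha, hx', by rw [hax]; exact hx'⟩) hax
    exact P.isOpenEmbedding.injective ((P.incl_π i' _).trans hx)
  · intro h i x a hx ha hax
    refine h (P.κ i) ⟨x, P.dom_subset i x.2⟩ a ?_ ((P.isLocalLift_iff hC hb).1 ha).1 hax
    rw [← P.incl_π]
    exact congrArg P.incl hx

theorem isCompatible (hC : C.IsOrbifold) (hb : C.boundary = ∅) (hφ : C.IsCompatible B) :
    P.toTriple.IsCompatible B := by
  obtain ⟨h, hh, K, hK⟩ := hφ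
  refine ⟨fun i => h (P.κ i), ⟨fun i s t => (hh.smooth _ s t).mono (P.dom_subset i),
    fun i x hx => hh.pos _ x (P.dom_subset i hx), fun g₀ i j x a A hA => ?_⟩, K, ?_⟩
  · exact hh.inv g₀ _ _ x a A ((P.isBundleLift_iff hC hb).1 hA).1
  · intro i x hx a A hA hax hA1 ξ hξ v
    have hπ : C.π (P.κ i) ⟨x, P.dom_subset i x.2⟩ = P.incl (P.π i x) := (P.incl_π i x).symm
    have := hK (P.κ i) ⟨x, P.dom_subset i x.2⟩
      (by rw [hπ]; exact (P.mem_vanishingSet hC hb _).1 hx) a A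
      ((P.isBundleLift_iff hC hb).1 hA).1 hax hA1 ξ hξ v
    rw [hπ] at this
    exact this

/-- A proper map stays proper on a closed subset. Closedness is needed only inside M^φ, not inside
M. -/
theorem isProperMap_φ (hC : C.IsOrbifold) (hb : C.boundary = ∅)
    (hprop : IsProperMap (fun m : C.vanishingSet => C.φ m))
    (hcl : IsClosed ((↑) ⁻¹' Set.range P.incl : Set C.vanishingSet)) :
    IsProperMap (fun m : P.toTriple.vanishingSet => P.toTriple.φ m) := by
  let f : P.toTriple.vanishingSet → C.vanishingSet :=
    fun m => ⟨P.incl m, (P.mem_vanishingSet hC hb m).1 m.2⟩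
  have hf : IsClosedEmbedding f := by
    refine ⟨?_, ?_⟩
    · exact IsEmbedding.of_comp (by
        exact Continuous.subtype_mk (P.isOpenEmbedding.continuous.comp continuous_subtype_val) _)
        continuous_subtype_val
        (P.isOpenEmbedding.isEmbedding.comp IsEmbedding.subtypeVal)
    · convert hcl
      ext m
      constructor
      · rintro ⟨m', rfl⟩
        exact ⟨_, rfl⟩
      · rintro ⟨m', hm⟩
        exact ⟨⟨m', (P.mem_vanishingSet hC hb m').2 (by rw [hm]; exact m.2)⟩, Subtype.ext hm⟩
  exact hprop.comp hf.isProperMap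

theorem isKCycle (hC : C.IsKCycle B)
    (hcl : IsClosed ((↑) ⁻¹' Set.range P.incl : Set C.vanishingSet)) :
    P.toTriple.IsKCycle B := by
  obtain ⟨⟨hO, hE, hJ, hφ, hprop, hcomp⟩, hb⟩ := hC
  exact ⟨⟨P.isOrbifold hO hb, P.isBundle hO hb hE, P.isStableComplex hO hb hJ,
    P.isEquivariantMap hφ, P.isProperMap_φ hO hb hprop hcl, P.isCompatible hO hb hcomp⟩,
    P.boundary_eq_empty hb⟩

end OpenPart

/-- All of `C`, as an open part of `C`. -/
def wholePart (C : GTriple (d := d) G k ρ) : OpenPart C where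
  X := C.X
  incl := id
  isOpenEmbedding := .id
  incl_smul := fun _ _ => rfl
  E := C.E
  inclE := id
  inclE_injective := Function.injective_id
  inclE_smul := fun _ _ => rfl
  p := C.p
  incl_p := fun _ => rfl
  ι := C.ι
  κ := id
  region := fun _ => univ
  isOpen_region := fun _ => isOpen_univ
  exists_chart := fun _ i => ⟨i, rfl, trivial⟩
  dom := C.dom
  mem_dom := fun _ _ => ⟨fun h => ⟨h, trivial⟩, fun h => h.1⟩
  π := C.π
  incl_π := fun _ _ => rfl
  triv := C.triv
  inclE_triv := fun _ _ _ => rfl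

/-- The restriction of `C` to an invariant open subset, as an open part of `C`. -/
def restrictPart (C : GTriple (d := d) G k ρ) (U : Set C.X) (hU : C.IsInvariant U)
    (hO : IsOpen U) : OpenPart C where
  X := U
  actX := (C.restrict U hU).actX
  incl := Subtype.val
  isOpenEmbedding := hO.isOpenEmbedding_subtypeVal
  incl_smul := fun _ _ => rfl
  E := (C.restrict U hU).E
  actE := (C.restrict U hU).actE
  inclE := Subtype.val
  inclE_injective := Subtype.val_injective
  inclE_smul := fun _ _ => rfl
  p := (C.restrict U hU).p
  incl_p := fun _ => rfl
  ι := C.ι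
  κ := id
  region := fun _ => U
  isOpen_region := fun _ => hO
  exists_chart := fun m i => ⟨i, rfl, m.2⟩
  dom := (C.restrict U hU).dom
  mem_dom := fun _ _ => Iff.rfl
  π := (C.restrict U hU).π
  incl_π := fun _ _ => rfl
  triv := (C.restrict U hU).triv
  inclE_triv := fun _ _ _ => rfl

theorem isOpenEmbedding_sigma_subtypeVal {A X : Type*} [TopologicalSpace X] {U : A → Set X}
    (hO : ∀ α, IsOpen (U α)) (hd : Pairwise fun α β => Disjoint (U α) (U β)) :
    IsOpenEmbedding (fun m : Σ α, U α => (m.2 : X)) := by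
  refine IsOpenEmbedding.of_continuous_injective_isOpenMap ?_ ?_ ?_
  · exact continuous_sigma fun α => continuous_subtype_val
  · rintro ⟨α, x, hx⟩ ⟨β, y, hy⟩ (rfl : x = y)
    obtain rfl : α = β := by
      by_contra h
      exact Set.disjoint_left.1 (hd h) hx hy
    rfl
  · exact isOpenMap_sigma.2 fun α => (hO α).isOpenMap_subtype_val

/-- The disjoint union of the restrictions of `C` to pairwise disjoint invariant open subsets, as an
open part of `C`. -/
def disjointUnionPart (C : GTriple (d := d) G k ρ) {A : Type} (U : A → Set C.X)
    (hU : ∀ α, C.IsInvariant (U α)) (hO : ∀ α, IsOpen (U α))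
    (hd : Pairwise fun α β => Disjoint (U α) (U β)) : OpenPart C :=
  let D := disjointUnion fun α => C.restrict (U α) (hU α)
  { X := D.X
    incl := fun m => m.2.1
    isOpenEmbedding := isOpenEmbedding_sigma_subtypeVal hO hd
    incl_smul := fun _ _ => rfl
    E := D.E
    inclE := fun e => e.2.1
    inclE_injective := by
      rintro ⟨α, e, he⟩ ⟨β, e', he'⟩ (rfl : e = e')
      obtain rfl : α = β := by
        by_contra h
        exact Set.disjoint_left.1 (hd h) he he'
      rfl
    inclE_smul := fun _ _ => rfl
    p := D.p
    incl_p := fun _ => rfl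
    ι := D.ι
    κ := fun i => i.2
    region := fun i => U i.1
    isOpen_region := fun i => hO i.1
    exists_chart := fun m i => ⟨⟨m.1, i⟩, rfl, m.2.2⟩
    dom := D.dom
    mem_dom := fun _ _ => Iff.rfl
    π := D.π
    incl_π := fun _ _ => rfl
    triv := D.triv
    inclE_triv := fun _ _ _ => rfl }

end OpenParts

end GTriple


/-! ### The cylinder: its stable complex structure, its charts and their domains. -/

/-- The reordering `V ⊕ ℝ ⊕ ℝᵏ⁺¹ = V ⊕ ℝᵏ ⊕ ℝ²`, in which `ℝ²` consists of the summand `ℝ` and of the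
first coordinate of `ℝᵏ⁺¹`. -/
def suspensionEquiv (V : Type*) [NormedAddCommGroup V] [NormedSpace ℝ V] (k : ℕ) :
    ((V × ℝ) × (Fin (k + 1) → ℝ)) ≃L[ℝ] ((V × (Fin k → ℝ)) × (ℝ × ℝ)) where
  toFun z := ((z.1.1, fun s => z.2 s.succ), (z.1.2, z.2 0))
  invFun w := ((w.1.1, w.2.1), Fin.cons w.2.2 w.1.2)
  map_add' _ _ := rfl
  map_smul' _ _ := rfl
  left_inv z := by
    refine Prod.ext rfl (funext fun s => ?_)
    refine Fin.cases rfl (fun _ => rfl) s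
  right_inv w := rfl
  continuous_toFun := by fun_prop
  continuous_invFun := by
    refine Continuous.prodMk (by fun_prop) (continuous_pi fun s => ?_)
    refine Fin.cases ?_ (fun s => ?_) s
    · simp only [Fin.cons_zero]; fun_prop
    · simp only [Fin.cons_succ]; fun_prop

/-- The map `V ⊕ ℝ ⊕ ℝᵏ⁺¹ → V' ⊕ ℝ ⊕ ℝᵏ⁺¹` that is given by `T` on `V ⊕ ℝᵏ` and by `q` on `ℝ²`. -/
def suspension {V V' : Type*} [NormedAddCommGroup V] [NormedSpace ℝ V]
    [NormedAddCommGroup V'] [NormedSpace ℝ V'] {k : ℕ} (q : ℝ × ℝ →L[ℝ] ℝ × ℝ)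
    (T : V × (Fin k → ℝ) →L[ℝ] V' × (Fin k → ℝ)) :
    ((V × ℝ) × (Fin (k + 1) → ℝ)) →L[ℝ] ((V' × ℝ) × (Fin (k + 1) → ℝ)) :=
  ((suspensionEquiv V' k).symm : _ →L[ℝ] _) ∘L (T.prodMap q) ∘L (suspensionEquiv V k : _ →L[ℝ] _)

theorem ContDiffOn.suspension {V V' X : Type*} [NormedAddCommGroup V] [NormedSpace ℝ V]
    [NormedAddCommGroup V'] [NormedSpace ℝ V'] [NormedAddCommGroup X] [NormedSpace ℝ X] {k : ℕ}
    (q : ℝ × ℝ →L[ℝ] ℝ × ℝ) {T : X → V × (Fin k → ℝ) →L[ℝ] V' × (Fin k → ℝ)} {s : Set X}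
    (hT : ContDiffOn ℝ ∞ T s) : ContDiffOn ℝ ∞ (fun x => _root_.suspension q (T x)) s := by
  have h1 : ContDiffOn ℝ ∞ (fun x => (T x).prodMap q) s :=
    (ContinuousLinearMap.prodMapL ℝ (V × (Fin k → ℝ)) (V' × (Fin k → ℝ)) (ℝ × ℝ)
      (ℝ × ℝ)).contDiff.comp_contDiffOn (hT.prodMk contDiffOn_const)
  exact contDiffOn_const.clm_comp (h1.clm_comp contDiffOn_const)

/-- The rotation `(x, y) ↦ (y, -x)` of the plane. -/
def clockwiseTurn : ℝ × ℝ →L[ℝ] ℝ × ℝ :=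
  (ContinuousLinearMap.snd ℝ ℝ ℝ).prod (-ContinuousLinearMap.fst ℝ ℝ ℝ)

/-- The sum of a representation on `ℝᵏ` and of the trivial representation on `ℝ`. -/
def trivialExtension {G : Type*} [Group G] {k : ℕ}
    (ρ : G →* ((Fin k → ℝ) →L[ℝ] (Fin k → ℝ))) :
    G →* ((Fin (k + 1) → ℝ) →L[ℝ] (Fin (k + 1) → ℝ)) where
  toFun g := (Fin.consEquivL ℝ (fun _ : Fin (k + 1) => ℝ) : _ →L[ℝ] _) ∘L
    ((ContinuousLinearMap.id ℝ ℝ).prodMap (ρ g)) ∘L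
    ((Fin.consEquivL ℝ (fun _ : Fin (k + 1) => ℝ)).symm : _ →L[ℝ] _)
  map_one' := by
    ext z s
    refine Fin.cases ?_ (fun _ => ?_) s <;> simp [Fin.tail]
  map_mul' g h := by
    ext z s
    refine Fin.cases ?_ (fun _ => ?_) s <;> simp

theorem continuous_trivialExtension {G : Type*} [Group G] [TopologicalSpace G] {k : ℕ}
    {ρ : G →* ((Fin k → ℝ) →L[ℝ] (Fin k → ℝ))} (hρ : Continuous ρ) :
    Continuous (trivialExtension ρ) := by
  have h : Continuous fun g => (ContinuousLinearMap.id ℝ ℝ).prodMap (ρ g) :=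
    (ContinuousLinearMap.prodMapL ℝ ℝ ℝ (Fin k → ℝ) (Fin k → ℝ)).continuous.comp
      (continuous_const.prodMk hρ)
  exact continuous_const.clm_comp (h.clm_comp continuous_const)

namespace GTriple

section Cylinder

variable {d : ℕ} {G : Type*} [Group G] [TopologicalSpace G]
  [ChartedSpace (EuclideanSpace ℝ (Fin d)) G] {k : ℕ}
  {ρ : G →* ((Fin k → ℝ) →L[ℝ] (Fin k → ℝ))}

/-- The subset `X × [0, 1) ∪ U × {1}` of `X × ℝ`. -/
def cylinderSet {X : Type*} (U : Set X) : Set (X × ℝ) :=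
  {m | 0 ≤ m.2 ∧ m.2 ≤ 1 ∧ (m.2 = 1 → m.1 ∈ U)}

/-- The end of the interval `[0, 1]` at which the charts of a given kind are centred. -/
def endpoint (b : Bool) : ℝ := if b then 1 else 0

/-- The sign of the inward direction at an end of the interval `[0, 1]`. -/
def inwardSign (b : Bool) : ℝ := if b then -1 else 1

/-- The triple `M × [0, 1] ∖ (M ∖ U) × {1}` for a triple `M` without boundary. The charts of index
`(i, b)` are centred at the end `endpoint b` of the interval. -/
abbrev cylinder (C : GTriple (d := d) G k ρ) (U : Set C.X) (hU : C.IsInvariant U) :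
    GTriple (d := d) G (k + 1) (trivialExtension ρ) where
  X := cylinderSet U
  actX :=
    { smul := fun g m => ⟨(g • m.1.1, m.1.2), m.2.1, m.2.2.1, fun h => hU g _ (m.2.2.2 h)⟩
      one_smul := fun m => Subtype.ext (Prod.ext (one_smul G m.1.1) rfl)
      mul_smul := fun g h m => Subtype.ext (Prod.ext (mul_smul g h m.1.1) rfl) }
  ι := C.ι × Bool
  V := fun i => C.V i.1 × ℝ
  normV := fun _ => Prod.normedAddCommGroup
  spaceV := fun _ => Prod.normedSpace
  ℓ := fun i => inwardSign i.2 • ContinuousLinearMap.snd ℝ (C.V i.1) ℝ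
  -- The second coordinate is measured from the chosen end, which puts that end on a hyperplane
  -- through 0; the bound `|x.2| < 1` excludes the opposite end.
  dom := fun i => {x | ∃ hx : x.1 ∈ C.dom i.1,
    (C.π i.1 ⟨x.1, hx⟩, x.2 + endpoint i.2) ∈ cylinderSet U ∧ |x.2| < 1}
  π := fun i x => ⟨(C.π i.1 ⟨x.1.1, x.2.1⟩, x.1.2 + endpoint i.2), x.2.2.1⟩
  E := {e : C.E × ℝ // (C.p e.1, e.2) ∈ cylinderSet U}
  actE :=
    { smul := fun g e => ⟨(g • e.1.1, e.1.2), e.2.1, e.2.2.1, fun h => by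
        show C.p (g • e.1.1) ∈ U
        rw [C.p_smul]
        exact hU g _ (e.2.2.2 h)⟩
      one_smul := fun m => Subtype.ext (Prod.ext (one_smul G m.1.1) rfl)
      mul_smul := fun g h m => Subtype.ext (Prod.ext (mul_smul g h m.1.1) rfl) }
  p := fun e => ⟨(C.p e.1.1, e.1.2), e.2⟩
  p_smul := fun g e => Subtype.ext (Prod.ext (C.p_smul g e.1.1) rfl)
  rk := fun i => C.rk i.1
  triv := fun i x v => ⟨(C.triv i.1 ⟨x.1.1, x.2.1⟩ v, x.1.2 + endpoint i.2), by
    rw [C.p_triv]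
    exact x.2.2.1⟩
  p_triv := fun i x v => Subtype.ext (Prod.ext (C.p_triv _ _ _) rfl)
  -- The interval direction is paired with one new trivial coordinate. Turning clockwise makes
  -- -∂/∂t, the outward normal at t = 0, the first vector of the positively oriented plane.
  J := fun i x => suspension clockwiseTurn (C.J i.1 x.1)
  φ := fun m => C.φ m.1.1

variable {C : GTriple (d := d) G k ρ} {U : Set C.X} {hU : C.IsInvariant U}

/-- A fibre is empty or a single orbit of the finite local group. Finite sets are discrete, which
later forces continuous paths in a fibre to be constant. -/
theorem IsOrbifold.finite_fibre (hC : C.IsOrbifold) (i : C.ι) (m : C.X) :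
    {z | ∃ hz : z ∈ C.dom i, C.π i ⟨z, hz⟩ = m}.Finite := by
  obtain ⟨Γ, hfin, -, hq⟩ := hC.quotient i
  rcases Set.eq_empty_or_nonempty {z | ∃ hz : z ∈ C.dom i, C.π i ⟨z, hz⟩ = m} with h | ⟨z₀, hz₀, h₀⟩
  · rw [h]; exact Set.finite_empty
  · refine (Set.finite_range fun γ : Γ =>
      ((γ : Equiv.Perm (C.dom i)) ⟨z₀, hz₀⟩ : C.V i)).subset ?_
    rintro z ⟨hz, h⟩
    obtain ⟨γ, hγ, h'⟩ := (hq ⟨z₀, hz₀⟩ ⟨z, hz⟩).1 (h₀.trans h.symm)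
    exact ⟨⟨γ, hγ⟩, congrArg Subtype.val h'⟩

theorem mem_cylinderSet_of_mem_uIcc {X : Type*} {U : Set X} {m : X} {s t r : ℝ}
    (hs : (m, s) ∈ cylinderSet U) (ht : (m, t) ∈ cylinderSet U) (hr : r ∈ uIcc s t) :
    (m, r) ∈ cylinderSet U := by
  obtain ⟨hs0, hs1, hs⟩ := hs
  obtain ⟨ht0, ht1, ht⟩ := ht
  simp only [] at hs0 hs1 hs ht0 ht1 ht
  rcases mem_uIcc.1 hr with ⟨h1, h2⟩ | ⟨h1, h2⟩
  · exact ⟨hs0.trans h1, h2.trans ht1,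
      fun h => ht (le_antisymm ht1 (by simp only [] at h; linarith))⟩
  · exact ⟨ht0.trans h1, h2.trans hs1,
      fun h => hs (le_antisymm hs1 (by simp only [] at h; linarith))⟩

/-- Chart domains are convex in the t-direction; this supplies the segments along which lifts are
shown to be constant. -/
theorem mem_cylinder_dom_of_mem_uIcc {i : C.ι} {b : Bool} {y : C.V i} {s t r : ℝ}
    (hs : (y, s) ∈ (C.cylinder U hU).dom (i, b)) (ht : (y, t) ∈ (C.cylinder U hU).dom (i, b))
    (hr : r ∈ uIcc s t) : (y, r) ∈ (C.cylinder U hU).dom (i, b) := by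
  obtain ⟨hy, hs, hs'⟩ := hs
  obtain ⟨_, ht, ht'⟩ := ht
  refine ⟨hy, mem_cylinderSet_of_mem_uIcc hs ht ?_, ?_⟩
  · rcases mem_uIcc.1 hr with ⟨h1, h2⟩ | ⟨h1, h2⟩
    · exact mem_uIcc.2 (Or.inl ⟨by simpa using h1, by simpa using h2⟩)
    · exact mem_uIcc.2 (Or.inr ⟨by simpa using h1, by simpa using h2⟩)
  · simp only [abs_lt] at hs' ht' ⊢
    rcases mem_uIcc.1 hr with ⟨h1, h2⟩ | ⟨h1, h2⟩ <;> constructor <;> linarith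

theorem isOpen_cylinder_slice (hC : C.IsOrbifold) (hb : C.boundary = ∅) (hO : IsOpen U)
    (i : C.ι) (b : Bool) (s : ℝ) : IsOpen {y | (y, s) ∈ (C.cylinder U hU).dom (i, b)} := by
  by_cases hs : 0 ≤ s + endpoint b ∧ s + endpoint b ≤ 1 ∧ |s| < 1
  swap
  · convert isOpen_empty
    rw [Set.eq_empty_iff_forall_notMem]
    rintro y ⟨_, h1, h2⟩
    exact hs ⟨h1.1, h1.2.1, h2⟩
  · have h : IsOpen {x : C.dom i | s + endpoint b = 1 → C.π i x ∈ U} := by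
      by_cases h : s + endpoint b = 1
      · simp only [h, true_implies]
        exact hO.preimage (hC.continuous i)
      · simp [h]
    convert (hC.isOpen_dom hb i).isOpenMap_subtype_val _ h
    ext y
    constructor
    · rintro ⟨hy, h1, h2⟩
      exact ⟨⟨y, hy⟩, h1.2.2, rfl⟩
    · rintro ⟨x, hx, rfl⟩
      exact ⟨x.2, ⟨hs.1, hs.2.1, hx⟩, hs.2.2⟩

theorem cylinder_dom_open (hC : C.IsOrbifold) (hb : C.boundary = ∅) (hO : IsOpen U)
    (i : (C.cylinder U hU).ι) : ∃ O : Set ((C.cylinder U hU).V i), IsOpen O ∧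
      (C.cylinder U hU).dom i = O ∩ {x | 0 ≤ (C.cylinder U hU).ℓ i x} := by
  obtain ⟨i, b⟩ := i
  have h1 : IsOpen (((C.dom i) ×ˢ univ) ∩ {y : C.V i × ℝ | |y.2| < 1}) :=
    ((hC.isOpen_dom hb i).prod isOpen_univ).inter
      (isOpen_lt (continuous_abs.comp continuous_snd) continuous_const)
  have h2 : IsOpen ((Subtype.val '' (C.π i ⁻¹' U)) ×ˢ univ ∪
      {y : C.V i × ℝ | y.2 + endpoint b < 1}) :=
    (((hC.isOpen_dom hb i).isOpenMap_subtype_val _ (hO.preimage (hC.continuous i))).prod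
      isOpen_univ).union (isOpen_lt (by fun_prop) continuous_const)
  refine ⟨_, h1.inter h2, ?_⟩
  ext ⟨y, t⟩
  -- Within distance 1 of one end, the inequality at the other end is automatic.
  have key : |t| < 1 → ((0 ≤ t + endpoint b ∧ t + endpoint b ≤ 1) ↔ 0 ≤ inwardSign b * t) := by
    intro ht
    rw [abs_lt] at ht
    cases b <;> simp [endpoint, inwardSign] <;> intros <;> linarith
  constructor
  · rintro ⟨hy, ⟨h0, h1, h2⟩, h3⟩
    refine ⟨⟨⟨⟨hy, trivial⟩, h3⟩, ?_⟩, (key h3).1 ⟨h0, h1⟩⟩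
    rcases eq_or_lt_of_le h1 with h | h
    · exact Or.inl ⟨⟨⟨y, hy⟩, h2 h, rfl⟩, trivial⟩
    · exact Or.inr h
  · rintro ⟨⟨⟨⟨hy, _⟩, h3⟩, h4⟩, h5⟩
    have := (key h3).2 h5
    refine ⟨hy, ⟨this.1, this.2, fun h => ?_⟩, h3⟩
    rcases h4 with ⟨⟨x, hx, rfl⟩, _⟩ | h4
    · exact hx
    · exact absurd h (ne_of_lt h4)

/-- The half space is convex with nonempty interior, and the domain is relatively open in it. Hence
`fderivWithin` can be computed, even on the boundary, from any known derivative. -/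
theorem cylinder_uniqueDiffOn (hC : C.IsOrbifold) (hb : C.boundary = ∅) (hO : IsOpen U)
    (i : C.ι) (b : Bool) : UniqueDiffOn ℝ ((C.cylinder U hU).dom (i, b)) := by
  obtain ⟨O, hO', h⟩ := C.cylinder_dom_open (hU := hU) hC hb hO (i, b)
  have h1 : UniqueDiffOn ℝ {x : C.V i × ℝ | 0 ≤ inwardSign b * x.2} := by
    refine uniqueDiffOn_convex ?_ ?_
    · exact convex_halfSpace_ge (f := fun x : C.V i × ℝ => inwardSign b * x.2)
        ⟨fun x y => by simp [mul_add], fun c x => by simp; ring⟩ 0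
    · refine ⟨(0, inwardSign b), interior_mono (s := {x : C.V i × ℝ | 0 < inwardSign b * x.2})
        (fun x hx => mem_ofPred.2 (le_of_lt (mem_ofPred.1 hx))) ?_⟩
      rw [(isOpen_lt continuous_const (by fun_prop)).interior_eq]
      cases b <;> simp [inwardSign]
  rw [h, inter_comm]
  exact UniqueDiffOn.inter h1 hO'

end Cylinder

end GTriple


/-! ### Neighbourhoods and derivatives in products with a line. -/

theorem eventually_prod_nhdsWithin_prod {X Y Z : Type*} [TopologicalSpace X] [TopologicalSpace Y]
    [PseudoMetricSpace Z] {g₀ : X} {x : Y} {s : Z} {D : Set (Y × Z)} {p : X × (Y × Z) → Prop}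
    (h : ∀ᶠ q in 𝓝 g₀ ×ˢ 𝓝[D] (x, s), p q) :
    ∃ (N : Set X) (O : Set Y) (δ : ℝ), IsOpen N ∧ g₀ ∈ N ∧ IsOpen O ∧ x ∈ O ∧ 0 < δ ∧
      ∀ g ∈ N, ∀ y ∈ O, ∀ t, dist t s < δ → (y, t) ∈ D → p (g, (y, t)) := by
  rw [← nhdsWithin_univ, ← nhdsWithin_prod_eq, eventually_nhdsWithin_iff] at h
  obtain ⟨N, M, hN, hgN, hM, hxM, hNM⟩ := mem_nhds_prod_iff'.1 h
  obtain ⟨O, I, hO, hxO, hI, hsI, hOI⟩ := mem_nhds_prod_iff'.1 (hM.mem_nhds hxM)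
  obtain ⟨δ, hδ, hδI⟩ := Metric.isOpen_iff.1 hI s hsI
  refine ⟨N, O, δ, hN, hgN, hO, hxO, hδ, fun g hg y hy t ht hD => ?_⟩
  exact hNM (a := (g, (y, t))) ⟨hg, hOI ⟨hy, hδI ht⟩⟩ ⟨trivial, hD⟩

theorem eventually_prod_nhdsWithin_of_eventually {X : Type*} [TopologicalSpace X] {g₀ : X}
    {V : Type*} [NormedAddCommGroup V]
    {x : V} {s : ℝ} {D : Set (V × ℝ)} {p : X × V → Prop}
    (h : ∀ᶠ q in 𝓝 (g₀, x), p q) :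
    ∀ᶠ q in 𝓝 g₀ ×ˢ 𝓝[D] (x, s), p (q.1, q.2.1) := by
  have h1 : Tendsto (fun q : X × (V × ℝ) => (q.1, q.2.1)) (𝓝 g₀ ×ˢ 𝓝[D] (x, s)) (𝓝 (g₀, x)) := by
    refine Tendsto.mono_left ?_ (Filter.prod_mono_right _ nhdsWithin_le_nhds)
    rw [← nhds_prod_eq]
    exact Continuous.tendsto (by fun_prop) (g₀, (x, s))
  exact h1.eventually h

section Slices

variable {d : ℕ} {G : Type*} [TopologicalSpace G] [ChartedSpace (EuclideanSpace ℝ (Fin d)) G]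
  {V V' : Type*} [NormedAddCommGroup V] [NormedSpace ℝ V] [NormedAddCommGroup V']
  [NormedSpace ℝ V']

theorem ContMDiffAt.differentiableAt_slice {a : G → V → V'} {g : G} {x : V}
    (h : ContMDiffAt ((𝓡 d).prod 𝓘(ℝ, V)) 𝓘(ℝ, V') ∞ (fun q : G × V => a q.1 q.2) (g, x)) :
    DifferentiableAt ℝ (a g) x := by
  have h1 : ContMDiffAt 𝓘(ℝ, V) ((𝓡 d).prod 𝓘(ℝ, V)) ∞ (fun y : V => (g, y)) x :=
    contMDiffAt_const.prodMk contMDiffAt_id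
  have h2 : ContMDiffAt 𝓘(ℝ, V) 𝓘(ℝ, V') ∞ (a g) x :=
    ContMDiffAt.comp (g := fun q : G × V => a q.1 q.2) x h h1
  exact h2.contDiffAt.differentiableAt (by simp)

theorem ContMDiffAt.mdifferentiableAt_slice {a : G → V → V'} {g : G} {x : V}
    (h : ContMDiffAt ((𝓡 d).prod 𝓘(ℝ, V)) 𝓘(ℝ, V') ∞ (fun q : G × V => a q.1 q.2) (g, x)) :
    MDifferentiableAt (𝓡 d) 𝓘(ℝ, V') (fun g => a g x) g := by
  have h1 : ContMDiffAt (𝓡 d) ((𝓡 d).prod 𝓘(ℝ, V)) ∞ (fun g : G => (g, x)) g :=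
    contMDiffAt_id.prodMk contMDiffAt_const
  have h2 : ContMDiffAt (𝓡 d) 𝓘(ℝ, V') ∞ (fun g => a g x) g :=
    ContMDiffAt.comp (g := fun q : G × V => a q.1 q.2) g h h1
  exact h2.mdifferentiableAt (by simp)

theorem contMDiff_prod_fst (V : Type*) [NormedAddCommGroup V] [NormedSpace ℝ V] :
    ContMDiff ((𝓡 d).prod 𝓘(ℝ, V × ℝ)) ((𝓡 d).prod 𝓘(ℝ, V)) ∞
      (fun q : G × (V × ℝ) => (q.1, q.2.1)) := by
  refine contMDiff_fst.prodMk ?_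
  exact (contDiff_fst.contMDiff (n := ∞)).comp contMDiff_snd

theorem contMDiff_prod_mk_right (V : Type*) [NormedAddCommGroup V] [NormedSpace ℝ V] (s : ℝ) :
    ContMDiff ((𝓡 d).prod 𝓘(ℝ, V)) ((𝓡 d).prod 𝓘(ℝ, V × ℝ)) ∞
      (fun q : G × V => (q.1, (q.2, s))) := by
  refine contMDiff_fst.prodMk ?_
  have h : ContDiff ℝ ∞ (fun y : V => (y, s)) := contDiff_id.prodMk contDiff_const
  exact h.contMDiff.comp contMDiff_snd

theorem HasFDerivAt.prod_add_const {a : V → V'} {T : V →L[ℝ] V'} {y : V × ℝ} (e : ℝ)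
    (h : HasFDerivAt a T y.1) :
    HasFDerivAt (fun z : V × ℝ => (a z.1, z.2 + e)) (T.prodMap (.id ℝ ℝ)) y := by
  have h1 : HasFDerivAt (fun z : V × ℝ => a z.1) (T ∘L ContinuousLinearMap.fst ℝ V ℝ) y :=
    HasFDerivAt.comp y h hasFDerivAt_fst
  exact h1.prodMk (hasFDerivAt_snd.add_const e)

theorem bijective_prodMap_id {T : V →L[ℝ] V'} :
    Function.Bijective (T.prodMap (.id ℝ ℝ)) ↔ Function.Bijective T := by
  rw [ContinuousLinearMap.coe_prodMap', Prod.map_bijective]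
  exact and_iff_left Function.bijective_id

end Slices

/-! ### Lifts of the action to the cylinder and to its bundle. -/

namespace GTriple

section Cylinder

variable {d : ℕ} {G : Type*} [Group G] [TopologicalSpace G]
  [ChartedSpace (EuclideanSpace ℝ (Fin d)) G] {k : ℕ}
  {ρ : G →* ((Fin k → ℝ) →L[ℝ] (Fin k → ℝ))}
  {C : GTriple (d := d) G k ρ} {U : Set C.X} {hU : C.IsInvariant U}

/-- A local lift of `C` defines a local lift of the cylinder. -/
theorem IsLocalLift.cylinder (hC : C.IsOrbifold) (hb : C.boundary = ∅) (hO : IsOpen U)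
    {g₀ : G} {i j : C.ι} {b b' : Bool} {x : C.V i} {s : ℝ} {a : G → C.V i → C.V j}
    (ha : C.IsLocalLift g₀ i j x a) (hx : (x, s) ∈ (C.cylinder U hU).dom (i, b))
    (hs : |s + (endpoint b - endpoint b')| < 1) :
    (C.cylinder U hU).IsLocalLift g₀ (i, b) (j, b') (x, s)
      (fun g y => (a g y.1, y.2 + (endpoint b - endpoint b'))) := by
  refine ⟨hx, ?_⟩
  have h1 := ((isLocalLift_iff_of_isOpen (hC.isOpen_dom hb i)).1 ha).2
  have h2 : ∀ᶠ q : G × (C.V i × ℝ) in 𝓝 g₀ ×ˢ 𝓝[(C.cylinder U hU).dom (i, b)] (x, s),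
      q.2 ∈ (C.cylinder U hU).dom (i, b) :=
    tendsto_snd.eventually eventually_mem_nhdsWithin
  have h3 : ∀ᶠ q : G × (C.V i × ℝ) in 𝓝 g₀ ×ˢ 𝓝[(C.cylinder U hU).dom (i, b)] (x, s),
      |q.2.2 + (endpoint b - endpoint b')| < 1 := by
    refine tendsto_snd.eventually (p := fun y : C.V i × ℝ =>
      |y.2 + (endpoint b - endpoint b')| < 1) (nhdsWithin_le_nhds ?_)
    exact (isOpen_lt (by fun_prop) continuous_const).mem_nhds hs
  filter_upwards [eventually_prod_nhdsWithin_of_eventually h1, h2, h3] with q hq1 hq2 hq3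
  obtain ⟨⟨hy, hay, he⟩, hsm, hbij⟩ := hq1
  obtain ⟨g, y, t⟩ := q
  have he' : t + (endpoint b - endpoint b') + endpoint b' = t + endpoint b := by ring
  simp only [] at hy hay he hsm hbij hq2 hq3
  refine ⟨⟨hq2, ⟨hay, ?_, hq3⟩, ?_⟩, ?_, ?_⟩
  · simp only [he, he']
    exact ⟨hq2.2.1.1, hq2.2.1.2.1, fun h => hU g _ (hq2.2.1.2.2 h)⟩
  · refine Subtype.ext (Prod.ext he he')
  · refine ContMDiffAt.contMDiffWithinAt ?_
    have h4 : ContMDiffAt ((𝓡 d).prod 𝓘(ℝ, C.V i × ℝ)) 𝓘(ℝ, C.V j) ∞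
        (fun q : G × (C.V i × ℝ) => a q.1 q.2.1) (g, (y, t)) :=
      ContMDiffAt.comp (g := fun q : G × C.V i => a q.1 q.2) (g, (y, t)) hsm
        (contMDiff_prod_fst (C.V i)).contMDiffAt
    refine h4.prodMk_space ?_
    have h5 : ContDiff ℝ ∞ (fun y : C.V i × ℝ => y.2 + (endpoint b - endpoint b')) := by fun_prop
    exact (h5.contMDiff.comp contMDiff_snd).contMDiffAt
  · have h6 := (HasFDerivAt.prod_add_const (y := (y, t)) (endpoint b - endpoint b')
      hsm.differentiableAt_slice.hasFDerivAt).hasFDerivWithinAt.fderivWithin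
      (cylinder_uniqueDiffOn (hU := hU) hC hb hO i b _ hq2)
    rw [tangentMap, h6, bijective_prodMap_id]
    exact hbij

/-- Every local lift of the cylinder comes from a local lift of `C`. -/
theorem exists_eq_of_isLocalLift_cylinder (hC : C.IsOrbifold) (hb : C.boundary = ∅)
    (hO : IsOpen U) {g₀ : G} {i j : C.ι} {b b' : Bool} {x : C.V i} {s : ℝ}
    {c : G → C.V i × ℝ → C.V j × ℝ}
    (hc : (C.cylinder U hU).IsLocalLift g₀ (i, b) (j, b') (x, s) c) :
    C.IsLocalLift g₀ i j x (fun g y => (c g (y, s)).1) ∧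
    |s + (endpoint b - endpoint b')| < 1 ∧
    ∀ᶠ q in 𝓝 g₀ ×ˢ 𝓝[(C.cylinder U hU).dom (i, b)] (x, s),
      c q.1 q.2 = ((c q.1 (q.2.1, s)).1, q.2.2 + (endpoint b - endpoint b')) := by
  obtain ⟨hx, hc⟩ := hc
  obtain ⟨N, O, δ, hN, hgN, hOo, hxO, hδ, H⟩ := eventually_prod_nhdsWithin_prod hc
  have hO' := hOo.inter (isOpen_cylinder_slice (hU := hU) hC hb hO i b s)
  set O' := O ∩ {y | (y, s) ∈ (C.cylinder U hU).dom (i, b)} 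
  -- The action fixes the true parameter, so the t-coordinate changes only by the shift between the
  -- two ends used as origins.
  have hsnd : ∀ g ∈ N, ∀ y ∈ O, ∀ t, dist t s < δ → (y, t) ∈ (C.cylinder U hU).dom (i, b) →
      (c g (y, t)).2 = t + (endpoint b - endpoint b') := by
    intro g hg y hy t ht hD
    obtain ⟨⟨h1, h2, h3⟩, -⟩ := H g hg y hy t ht hD
    have h4 : (c g (y, t)).2 + endpoint b' = t + endpoint b := congrArg (fun m => m.1.2) h3
    linarith
  have hfst : ∀ g ∈ N, ∀ y ∈ O', ∀ t, dist t s < δ → (y, t) ∈ (C.cylinder U hU).dom (i, b) →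
      (c g (y, t)).1 = (c g (y, s)).1 := by
    intro g hg y hy t ht hD
    have hyd := hD.1
    have hdist : ∀ r ∈ uIcc s t, dist r s < δ := fun r hr => by
      rw [Real.dist_eq] at ht ⊢
      exact lt_of_le_of_lt (abs_sub_left_of_mem_uIcc hr) ht
    have hfin := hC.finite_fibre j (g • C.π i ⟨y, hyd⟩)
    -- As r runs over the segment, the first component stays over the single point `g • π y`, thus
    -- in a finite set; being continuous, it is constant.
    refine (isPreconnected_uIcc (a := s) (b := t)).constant_of_mapsTo
      (T := {z | ∃ hz : z ∈ C.dom j, C.π j ⟨z, hz⟩ = g • C.π i ⟨y, hyd⟩})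
      (f := fun r => (c g (y, r)).1) hfin.isDiscrete ?_ ?_ right_mem_uIcc left_mem_uIcc
    · intro r hr
      have hrD := mem_cylinder_dom_of_mem_uIcc hy.2 hD hr
      have h1 := (H g hg y hy.1 r (hdist r hr) hrD).2.1.continuousWithinAt
      have h2 : ContinuousWithinAt (fun r : ℝ => (g, (y, r))) (uIcc s t) r := by fun_prop
      exact continuous_fst.continuousAt.comp_continuousWithinAt
        (ContinuousWithinAt.comp (g := fun q : G × (C.V i × ℝ) => c q.1 q.2)
          (f := fun r : ℝ => (g, (y, r))) h1 h2
          fun r' hr' => ⟨trivial, mem_cylinder_dom_of_mem_uIcc hy.2 hD hr'⟩)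
    · intro r hr
      have hrD := mem_cylinder_dom_of_mem_uIcc hy.2 hD hr
      obtain ⟨⟨h1, h2, h3⟩, -⟩ := H g hg y hy.1 r (hdist r hr) hrD
      exact ⟨h2.1, congrArg (fun m => m.1.1) h3⟩
  have heq : ∀ g ∈ N, ∀ y ∈ O', ∀ t, dist t s < δ → (y, t) ∈ (C.cylinder U hU).dom (i, b) →
      c g (y, t) = ((c g (y, s)).1, t + (endpoint b - endpoint b')) := fun g hg y hy t ht hD =>
    Prod.ext (hfst g hg y hy t ht hD) (hsnd g hg y hy.1 t ht hD)
  have hss : dist s s < δ := by rwa [dist_self]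
  refine ⟨?_, ?_, ?_⟩
  · refine (isLocalLift_iff_of_isOpen (hC.isOpen_dom hb i)).2 ⟨hx.1, ?_⟩
    filter_upwards [(hN.prod hO').mem_nhds (show (g₀, x) ∈ N ×ˢ O' from ⟨hgN, hxO, hx⟩)] with q hq
    obtain ⟨g, y⟩ := q
    obtain ⟨hg, hy⟩ := hq
    simp only [] at hg hy
    obtain ⟨⟨h1, h2, h3⟩, h4, h5⟩ := H g hg y hy.1 s hss hy.2
    refine ⟨⟨h1.1, h2.1, congrArg (fun m => m.1.1) h3⟩, ?_⟩
    have h6 : ContMDiffAt ((𝓡 d).prod 𝓘(ℝ, C.V i)) 𝓘(ℝ, C.V j × ℝ) ∞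
        (fun q : G × C.V i => c q.1 (q.2, s)) (g, y) := by
      have := ContMDiffWithinAt.comp (g := fun q : G × (C.V i × ℝ) => c q.1 q.2) (g, y) h4
        (contMDiff_prod_mk_right (G := G) (C.V i) s).contMDiffAt.contMDiffWithinAt
        (s := univ ×ˢ O') (t := univ ×ˢ (C.cylinder U hU).dom (i, b))
        (fun q hq => ⟨trivial, hq.2.2⟩)
      exact this.contMDiffAt ((isOpen_univ.prod hO').mem_nhds
        (show (g, y) ∈ (univ : Set G) ×ˢ O' from ⟨trivial, hy⟩))
    have h7 : ContMDiffAt ((𝓡 d).prod 𝓘(ℝ, C.V i)) 𝓘(ℝ, C.V j) ∞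
        (fun q : G × C.V i => (c q.1 (q.2, s)).1) (g, y) :=
      (contDiff_fst.contMDiff (n := ∞)).contMDiffAt.comp (g, y) h6
    refine ⟨h7, ?_⟩
    have h8 := (HasFDerivAt.prod_add_const (y := (y, s)) (endpoint b - endpoint b')
      (h7.differentiableAt_slice (a := fun g y => (c g (y, s)).1)).hasFDerivAt).hasFDerivWithinAt
        |>.fderivWithin
      (cylinder_uniqueDiffOn (hU := hU) hC hb hO i b _ hy.2)
    -- By the product form, the derivative of `c g` is that of the slice times the identity, so its
    -- bijectivity passes to the slice.
    have h9 : c g =ᶠ[𝓝[(C.cylinder U hU).dom (i, b)] (y, s)]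
        fun z => ((c g (z.1, s)).1, z.2 + (endpoint b - endpoint b')) := by
      filter_upwards [eventually_mem_nhdsWithin, mem_nhdsWithin_of_mem_nhds
        ((hO'.prod (Metric.isOpen_ball (x := s) (ε := δ))).mem_nhds
          (show (y, s) ∈ _ from ⟨hy, Metric.mem_ball_self hδ⟩))] with z hz hz'
      exact heq g hg z.1 hz'.1 z.2 hz'.2 hz
    simp only [tangentMap] at h5
    rw [h9.fderivWithin_eq (heq g hg y hy s hss hy.2), h8, bijective_prodMap_id] at h5
    exact h5
  · obtain ⟨⟨h1, h2, h3⟩, -⟩ := H g₀ hgN x hxO s hss hx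
    have := h2.2.2
    simp only [hsnd g₀ hgN x hxO s hss hx] at this
    exact this
  · rw [← nhdsWithin_univ, ← nhdsWithin_prod_eq]
    filter_upwards [eventually_mem_nhdsWithin, mem_nhdsWithin_of_mem_nhds
      ((hN.prod (hO'.prod (Metric.isOpen_ball (x := s) (ε := δ)))).mem_nhds
        (show (g₀, (x, s)) ∈ _ from ⟨hgN, ⟨hxO, hx⟩, Metric.mem_ball_self hδ⟩))] with q hq hq'
    exact heq q.1 hq'.1 q.2.1 hq'.2.1 q.2.2 hq'.2.2 hq.2

theorem tangentMap_cylinder (hC : C.IsOrbifold) (hb : C.boundary = ∅)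
    (hO : IsOpen U) {g₀ : G} {i j : C.ι} {b b' : Bool} {x : C.V i} {s : ℝ}
    {c : G → C.V i × ℝ → C.V j × ℝ}
    (hc : (C.cylinder U hU).IsLocalLift g₀ (i, b) (j, b') (x, s) c) :
    (C.cylinder U hU).tangentMap (i := (i, b)) (j := (j, b')) c g₀ (x, s) =
      (C.tangentMap (i := i) (j := j) (fun g y => (c g (y, s)).1) g₀ x).prodMap (.id ℝ ℝ) := by
  obtain ⟨ha, -, h⟩ := exists_eq_of_isLocalLift_cylinder hC hb hO hc
  have h1 := ((isLocalLift_iff_of_isOpen (hC.isOpen_dom hb i)).1 ha).2.self_of_nhds.2.1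
  have h2 := (HasFDerivAt.prod_add_const (y := (x, s)) (endpoint b - endpoint b')
      (h1.differentiableAt_slice (a := fun g y => (c g (y, s)).1)).hasFDerivAt).hasFDerivWithinAt
        |>.fderivWithin
      (cylinder_uniqueDiffOn (hU := hU) hC hb hO i b _ hc.1)
  have h3 : c g₀ =ᶠ[𝓝[(C.cylinder U hU).dom (i, b)] (x, s)]
      fun z => ((c g₀ (z.1, s)).1, z.2 + (endpoint b - endpoint b')) := h.curry.self_of_nhds
  unfold tangentMap
  rw [h3.fderivWithin_eq (h3.self_of_nhdsWithin hc.1),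
    fderivWithin_of_isOpen (hC.isOpen_dom hb i) ha.1]
  exact h2

/-- Along an orbit the t-coordinate is locally constant, so the generating vector fields are tangent
to the slices. -/
theorem infinitesimal_cylinder (hC : C.IsOrbifold) (hb : C.boundary = ∅)
    (hO : IsOpen U) {i : C.ι} {b : Bool} {x : C.V i} {s : ℝ}
    {c : G → C.V i × ℝ → C.V i × ℝ}
    (hc : (C.cylinder U hU).IsLocalLift 1 (i, b) (i, b) (x, s) c) (ξ : GroupLieAlgebra (𝓡 d) G) :
    (C.cylinder U hU).infinitesimal (i := (i, b)) c (x, s) ξ =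
      (C.infinitesimal (i := i) (fun g y => (c g (y, s)).1) x ξ, 0) := by
  obtain ⟨ha, -, h⟩ := exists_eq_of_isLocalLift_cylinder hC hb hO hc
  have h1 := ((isLocalLift_iff_of_isOpen (hC.isOpen_dom hb i)).1 ha).2.self_of_nhds.2.1
  have h2 : Tendsto (fun g : G => (g, (x, s))) (𝓝 1)
      (𝓝 1 ×ˢ 𝓝[(C.cylinder U hU).dom (i, b)] (x, s)) :=
    tendsto_id.prodMk (tendsto_const_pure.mono_right (pure_le_nhdsWithin hc.1))
  have h3 : (fun g => c g (x, s)) =ᶠ[𝓝 1]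
      fun g => ((c g (x, s)).1, s + (endpoint b - endpoint b)) := h2.eventually h
  have h4 := h1.mdifferentiableAt_slice (a := fun g y => (c g (y, s)).1)
  have h5 : HasMFDerivAt (𝓡 d) 𝓘(ℝ, C.V i × ℝ)
      (fun g => ((c g (x, s)).1, s + (endpoint b - endpoint b))) 1
      ((mfderiv (𝓡 d) 𝓘(ℝ, C.V i) (fun g => (c g (x, s)).1) 1).prod
        (0 : EuclideanSpace ℝ (Fin d) →L[ℝ] ℝ)) :=
    ⟨h4.hasMFDerivAt.1.prodMk continuousAt_const,
      h4.hasMFDerivAt.2.prodMk (hasFDerivWithinAt_const _ _ _)⟩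
  unfold infinitesimal
  rw [h3.mfderiv_eq]
  exact congrArg (fun T => T ξ) h5.mfderiv

theorem IsBundleLift.cylinder (hC : C.IsOrbifold) (hb : C.boundary = ∅)
    {g₀ : G} {i j : C.ι} {b b' : Bool} {x : C.V i} {s : ℝ} {a : G → C.V i → C.V j}
    {A : G → C.V i → (CVec (C.rk i) →L[ℂ] CVec (C.rk j))}
    (hA : C.IsBundleLift g₀ i j x a A)
    {c : G → C.V i × ℝ → C.V j × ℝ}
    (hc : (C.cylinder U hU).IsLocalLift g₀ (i, b) (j, b') (x, s) c)
    (hca : ∀ᶠ q in 𝓝 g₀ ×ˢ 𝓝[(C.cylinder U hU).dom (i, b)] (x, s),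
      c q.1 q.2 = (a q.1 q.2.1, q.2.2 + (endpoint b - endpoint b'))) :
    (C.cylinder U hU).IsBundleLift g₀ (i, b) (j, b') (x, s) c (fun g y => A g y.1) := by
  refine ⟨hc, ?_⟩
  have h1 := ((isBundleLift_iff_of_isOpen (hC.isOpen_dom hb i)).1 hA).2
  filter_upwards [eventually_prod_nhdsWithin_of_eventually h1, hc.2, hca] with q hq1 hq2 hq3
  obtain ⟨⟨hy, hay, he⟩, hsm, hbij⟩ := hq1
  obtain ⟨g, y, t⟩ := q
  obtain ⟨⟨h2, h3, h4⟩, -⟩ := hq2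
  simp only [] at hy hay he hsm hbij hq3
  refine ⟨⟨h2, h3, fun v => Subtype.ext (Prod.ext ?_ ?_)⟩, ?_, hbij⟩
  · refine Eq.trans ?_ (he v)
    -- The point carries a membership proof, so it is generalized before the equality is
    -- substituted.
    have : ∀ z (hz : z ∈ C.dom j), z = a g y → C.triv j ⟨z, hz⟩ (A g y v) =
        C.triv j ⟨a g y, hay⟩ (A g y v) := by
      rintro z hz rfl
      rfl
    exact this _ h3.1 (congrArg Prod.fst hq3)
  · exact congrArg (fun m => m.1.2) h4
  · refine ContMDiffAt.contMDiffWithinAt ?_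
    exact ContMDiffAt.comp (g := fun q : G × C.V i => A q.1 q.2) (g, (y, t)) hsm
        (contMDiff_prod_fst (C.V i)).contMDiffAt

/-- Restriction to the slice at `s`. The slice of the domain is open even when `s` is at an end, so
smoothness within the domain becomes smoothness at the point. -/
theorem isBundleLift_of_cylinder (hC : C.IsOrbifold) (hb : C.boundary = ∅) (hO : IsOpen U)
    {g₀ : G} {i j : C.ι} {b b' : Bool} {x : C.V i} {s : ℝ}
    {c : G → C.V i × ℝ → C.V j × ℝ} {A : G → C.V i × ℝ → (CVec (C.rk i) →L[ℂ] CVec (C.rk j))}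
    (hA : (C.cylinder U hU).IsBundleLift g₀ (i, b) (j, b') (x, s) c A) :
    C.IsBundleLift g₀ i j x (fun g y => (c g (y, s)).1) (fun g y => A g (y, s)) := by
  refine (isBundleLift_iff_of_isOpen (hC.isOpen_dom hb i)).2
    ⟨(exists_eq_of_isLocalLift_cylinder hC hb hO hA.1).1, ?_⟩
  obtain ⟨N, O, δ, hN, hgN, hOo, hxO, hδ, H⟩ := eventually_prod_nhdsWithin_prod hA.2
  have hO' := hOo.inter (isOpen_cylinder_slice (hU := hU) hC hb hO i b s)
  set O' := O ∩ {y | (y, s) ∈ (C.cylinder U hU).dom (i, b)}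
  filter_upwards [(hN.prod hO').mem_nhds (show (g₀, x) ∈ N ×ˢ O' from ⟨hgN, hxO, hA.1.1⟩)] with q hq
  obtain ⟨g, y⟩ := q
  obtain ⟨hg, hy⟩ := hq
  simp only [] at hg hy
  obtain ⟨⟨h1, h2, h3⟩, h4, h5⟩ := H g hg y hy.1 s (by rwa [dist_self]) hy.2
  refine ⟨⟨h1.1, h2.1, fun v => congrArg (fun m => m.1.1) (h3 v)⟩, ?_, h5⟩
  have := ContMDiffWithinAt.comp (g := fun q : G × (C.V i × ℝ) => A q.1 q.2) (g, y) h4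
    (contMDiff_prod_mk_right (G := G) (C.V i) s).contMDiffAt.contMDiffWithinAt
    (s := univ ×ˢ O') (t := univ ×ˢ (C.cylinder U hU).dom (i, b))
    (fun q hq => ⟨trivial, hq.2.2⟩)
  exact this.contMDiffAt ((isOpen_univ.prod hO').mem_nhds
        (show (g, y) ∈ (univ : Set G) ×ˢ O' from ⟨trivial, hy⟩))

end Cylinder

end GTriple


/-! ### The cylinder is a K-chain. -/

namespace GTriple

section Cylinder

variable {d : ℕ} {G : Type*} [Group G] [TopologicalSpace G]
  [ChartedSpace (EuclideanSpace ℝ (Fin d)) G] {k : ℕ}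
  {ρ : G →* ((Fin k → ℝ) →L[ℝ] (Fin k → ℝ))}
  {C : GTriple (d := d) G k ρ} {U : Set C.X} {hU : C.IsInvariant U}
  {B : GroupLieAlgebra (𝓡 d) G →ₗ[ℝ] GroupLieAlgebra (𝓡 d) G →ₗ[ℝ] ℝ}

theorem exists_abs_sub_endpoint_lt {t : ℝ} (h0 : 0 ≤ t) (h1 : t ≤ 1) :
    ∃ b : Bool, |t - endpoint b| < 1 := by
  rcases eq_or_lt_of_le h1 with rfl | h
  · exact ⟨true, by simp [endpoint]⟩
  · exact ⟨false, by simp [endpoint, abs_lt]; constructor <;> linarith⟩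

theorem cylinder_cover (hC : C.IsOrbifold) (m : (C.cylinder U hU).X) :
    ∃ i, ∃ x : (C.cylinder U hU).dom i, (C.cylinder U hU).π i x = m := by
  obtain ⟨⟨m, t⟩, hm⟩ := m
  obtain ⟨i, x, rfl⟩ := hC.cover m
  obtain ⟨b, hb⟩ := exists_abs_sub_endpoint_lt hm.1 hm.2.1
  have hx : (x.1, t - endpoint b) ∈ (C.cylinder U hU).dom (i, b) :=
    ⟨x.2, by rw [sub_add_cancel]; exact hm, hb⟩
  exact ⟨(i, b), ⟨_, hx⟩, Subtype.ext (Prod.ext rfl (sub_add_cancel _ _))⟩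

theorem continuous_cylinder_π (hC : C.IsOrbifold) (i : (C.cylinder U hU).ι) :
    Continuous ((C.cylinder U hU).π i) := by
  refine Continuous.subtype_mk (Continuous.prodMk ?_ ?_) _
  · refine (hC.continuous i.1).comp (Continuous.subtype_mk ?_ _)
    exact continuous_fst.comp continuous_subtype_val
  · exact (continuous_snd.comp continuous_subtype_val).add continuous_const

/-- The chart map is the restriction to the cylinder of the open map `π × translation`, applied to
sets truncated to `|y.2| < 1`. -/
theorem isOpenMap_cylinder_π (hC : C.IsOrbifold) (i : (C.cylinder U hU).ι) :
    IsOpenMap ((C.cylinder U hU).π i) := by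
  rintro _ ⟨O, hO, rfl⟩
  have h1 : IsOpen {y : C.dom i.1 × ℝ | (y.1.1, y.2) ∈ O ∧ |y.2| < 1} :=
    (hO.preimage (f := fun y : C.dom i.1 × ℝ => (y.1.1, y.2))
      ((continuous_subtype_val.comp continuous_fst).prodMk continuous_snd)).inter
      (isOpen_lt (continuous_abs.comp continuous_snd) continuous_const)
  have h2 := (hC.openMap i.1).prodMap (Homeomorph.addRight (endpoint i.2)).isOpenMap _ h1
  refine ⟨_, h2, ?_⟩
  ext ⟨w, hw⟩
  constructor
  · rintro ⟨⟨x, s⟩, ⟨hx, hs⟩, rfl⟩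
    exact ⟨⟨(x.1, s), x.2, hw, hs⟩, hx, rfl⟩
  · rintro ⟨⟨⟨x, s⟩, hx, hw', hs⟩, hO, h⟩
    exact ⟨(⟨x, hx⟩, s), ⟨hO, hs⟩, congrArg Subtype.val h⟩

theorem cylinder_quotient (hC : C.IsOrbifold) (i : (C.cylinder U hU).ι) :
    ∃ Γ : Subgroup (Equiv.Perm ((C.cylinder U hU).dom i)), Finite Γ ∧
    (∀ γ ∈ Γ, ∃ f : (C.cylinder U hU).V i → (C.cylinder U hU).V i,
      ContDiffOn ℝ ∞ f ((C.cylinder U hU).dom i) ∧ ∀ x : (C.cylinder U hU).dom i, f x = γ x) ∧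
    ∀ x y, (C.cylinder U hU).π i x = (C.cylinder U hU).π i y ↔ ∃ γ ∈ Γ, γ x = y := by
  obtain ⟨i, b⟩ := i
  obtain ⟨Γ, hfin, hsm, hq⟩ := hC.quotient i
  have hmem : ∀ (γ : Γ) (x : (C.cylinder U hU).dom (i, b)),
      (((γ : Equiv.Perm (C.dom i)) ⟨x.1.1, x.2.1⟩ : C.V i), x.1.2) ∈
        (C.cylinder U hU).dom (i, b) := by
    intro γ x
    refine ⟨Subtype.coe_prop _, ?_, x.2.2.2⟩
    have := (hq ⟨x.1.1, x.2.1⟩ _).2 ⟨γ, γ.2, rfl⟩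
    rw [Subtype.coe_eta, ← this]
    exact x.2.2.1
  let _ : MulAction Γ ((C.cylinder U hU).dom (i, b)) :=
    { smul := fun γ x => ⟨_, hmem γ x⟩
      one_smul := fun x => rfl
      mul_smul := fun γ γ' x => rfl }
  refine ⟨(MulAction.toPermHom Γ ((C.cylinder U hU).dom (i, b))).range,
    finite_range_toPermHom _ _, ?_, ?_⟩
  · rintro _ ⟨γ, rfl⟩
    obtain ⟨f, hf, hf'⟩ := hsm γ γ.2
    refine ⟨fun x => (f x.1, x.2), ?_, fun x => Prod.ext (hf' ⟨x.1.1, x.2.1⟩) rfl⟩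
    exact (hf.comp contDiff_fst.contDiffOn fun x hx => hx.1).prodMk contDiff_snd.contDiffOn
  · intro x y
    constructor
    · intro h
      have h1 : C.π i ⟨x.1.1, x.2.1⟩ = C.π i ⟨y.1.1, y.2.1⟩ := congrArg (fun m => m.1.1) h
      have h2 : x.1.2 + endpoint b = y.1.2 + endpoint b := congrArg (fun m => m.1.2) h
      obtain ⟨γ, hγ, h3⟩ := (hq _ _).1 h1
      exact ⟨_, ⟨⟨γ, hγ⟩, rfl⟩,
        Subtype.ext (Prod.ext (congrArg Subtype.val h3) (add_right_cancel h2))⟩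
    · rintro ⟨_, ⟨γ, rfl⟩, rfl⟩
      refine Subtype.ext (Prod.ext ?_ rfl)
      exact (hq _ _).2 ⟨γ, γ.2, rfl⟩

theorem cylinder_isOrbifold (hC : C.IsOrbifold) (hb : C.boundary = ∅) (hO : IsOpen U) :
    (C.cylinder U hU).IsOrbifold where
  t2 := haveI := hC.t2; inferInstanceAs (T2Space (cylinderSet U))
  secondCountable :=
    haveI := hC.secondCountable
    inferInstanceAs (SecondCountableTopology (cylinderSet U))
  dom_open := C.cylinder_dom_open hC hb hO
  cover := cylinder_cover hC
  continuous := continuous_cylinder_π hC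
  openMap := isOpenMap_cylinder_π hC
  quotient := cylinder_quotient hC
  lift := by
    rintro g₀ ⟨i, b⟩ ⟨j, b'⟩ ⟨⟨x, s⟩, hx⟩ ⟨⟨y, t⟩, hy⟩ h
    have h1 : g₀ • C.π i ⟨x, hx.1⟩ = C.π j ⟨y, hy.1⟩ := congrArg (fun m => m.1.1) h
    have h2 : s + endpoint b = t + endpoint b' := congrArg (fun m => m.1.2) h
    have h3 : s + (endpoint b - endpoint b') = t := by linarith
    obtain ⟨a, ha, hax⟩ := hC.lift g₀ i j _ _ h1
    refine ⟨_, ha.cylinder hC hb hO hx (b' := b') (by rw [h3]; exact hy.2.2), ?_⟩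
    exact Prod.ext hax h3

theorem cylinder_isBundle (hC : C.IsOrbifold) (hb : C.boundary = ∅) (hO : IsOpen U)
    (hE : C.IsBundle) : (C.cylinder U hU).IsBundle where
  surj := by
    rintro ⟨⟨e, t⟩, he⟩ ⟨i, b⟩ ⟨⟨x, s⟩, hx⟩ h
    obtain ⟨v, hv⟩ := hE.surj e i ⟨x, hx.1⟩ (congrArg (fun m => m.1.1) h)
    exact ⟨v, Subtype.ext (Prod.ext hv (congrArg (fun m => m.1.2) h))⟩
  lift := by
    rintro g₀ ⟨i, b⟩ ⟨j, b'⟩ ⟨x, s⟩ c hc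
    obtain ⟨ha, -, h⟩ := exists_eq_of_isLocalLift_cylinder hC hb hO hc
    obtain ⟨A, hA⟩ := hE.lift g₀ i j x _ ha
    exact ⟨_, hA.cylinder hC hb hc h⟩
  fibre := by
    rintro ⟨i, b⟩ ⟨⟨x, s⟩, hx⟩ v w h
    obtain ⟨a, A, hA, hax, hAv⟩ :=
      hE.fibre i ⟨x, hx.1⟩ v w (congrArg (fun e => e.1.1) h)
    have hs : s + (endpoint b - endpoint b) = s := by rw [sub_self, add_zero]
    have hc := hA.1.cylinder hC hb hO hx (b' := b) (by rw [hs]; exact hx.2.2)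
    exact ⟨_, _, hA.cylinder hC hb hc (Eventually.of_forall fun _ => rfl),
      Prod.ext hax hs, hAv⟩
  unique := by
    rintro ⟨i, b⟩ ⟨x, s⟩ c A hA h
    refine hE.unique i x _ _ (isBundleLift_of_cylinder hC hb hO hA) ?_
    have h1 : Tendsto (fun y : C.V i => (y, s)) (𝓝[C.dom i] x)
        (𝓝[(C.cylinder U hU).dom (i, b)] (x, s)) := by
      refine Tendsto.mono_left (tendsto_nhdsWithin_iff.2 ⟨?_, ?_⟩) nhdsWithin_le_nhds
      · exact Continuous.tendsto (by fun_prop) x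
      · exact (isOpen_cylinder_slice (hU := hU) hC hb hO i b s).mem_nhds hA.1.1
    exact (h1.eventually h).mono fun y hy => congrArg Prod.fst hy

theorem cylinder_isStableComplex (hC : C.IsOrbifold) (hb : C.boundary = ∅) (hO : IsOpen U)
    (hJ : C.IsStableComplex) : (C.cylinder U hU).IsStableComplex where
  cont := continuous_trivialExtension hJ.cont
  smooth := fun i => ContDiffOn.suspension _
    ((hJ.smooth i.1).comp contDiff_fst.contDiffOn fun x hx => hx.1)
  sq := by
    rintro ⟨i, b⟩ ⟨x, s⟩ hx z
    have h := hJ.sq i x hx.1 (z.1.1, fun s => z.2 s.succ)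
    have h1 := congrArg Prod.fst h
    have h2 := congrFun (congrArg Prod.snd h)
    refine Prod.ext (Prod.ext h1 rfl) (funext fun s => ?_)
    refine Fin.cases ?_ (fun s => ?_) s
    · rfl
    · exact h2 s
  inv := by
    rintro g₀ ⟨i, b⟩ ⟨j, b'⟩ ⟨x, s⟩ c hc z
    obtain ⟨ha, -, -⟩ := exists_eq_of_isLocalLift_cylinder hC hb hO hc
    have h := hJ.inv g₀ i j x _ ha (z.1.1, fun s => z.2 s.succ)
    have h' := tangentMap_cylinder hC hb hO hc
    rw [h']
    have h1 := congrArg Prod.fst h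
    have h2 := congrFun (congrArg Prod.snd h)
    refine Prod.ext (Prod.ext h1 rfl) (funext fun s => ?_)
    refine Fin.cases ?_ (fun s => ?_) s
    · rfl
    · exact h2 s

theorem cylinder_isEquivariantMap (hφ : C.IsEquivariantMap) :
    (C.cylinder U hU).IsEquivariantMap where
  equivariant := fun g m => hφ.equivariant g m.1.1
  smooth := by
    rintro ⟨i, b⟩
    obtain ⟨f, hf, h⟩ := hφ.smooth i
    exact ⟨fun x => f x.1, hf.comp contDiff_fst.contDiffOn fun x hx => hx.1,
      fun x => h ⟨x.1.1, x.2.1⟩⟩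

theorem mem_cylinder_vanishingSet (hC : C.IsOrbifold) (hb : C.boundary = ∅) (hO : IsOpen U)
    (m : (C.cylinder U hU).X) :
    m ∈ (C.cylinder U hU).vanishingSet ↔ m.1.1 ∈ C.vanishingSet := by
  constructor
  · intro h i x a hx ha hax
    -- Either end will do as origin, provided that the point is at distance less than 1 from it.
    obtain ⟨b, hb'⟩ := exists_abs_sub_endpoint_lt m.2.1 m.2.2.1
    have hxd : (x.1, m.1.2 - endpoint b) ∈ (C.cylinder U hU).dom (i, b) :=
      ⟨x.2, by rw [sub_add_cancel]; simp only [Subtype.coe_eta, hx]; exact m.2, hb'⟩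
    have hs : m.1.2 - endpoint b + (endpoint b - endpoint b) = m.1.2 - endpoint b := by ring
    have hc := ha.cylinder hC hb hO hxd (b' := b) (by rw [hs]; exact hb')
    have h1 := h (i, b) ⟨_, hxd⟩ _ (Subtype.ext (Prod.ext hx (sub_add_cancel _ _))) hc
      (Prod.ext hax hs)
    have h2 := (infinitesimal_cylinder hC hb hO hc (-(C.φ m.1.1))).symm.trans h1
    exact congrArg Prod.fst h2
  · rintro h ⟨i, b⟩ ⟨⟨x, s⟩, hx⟩ c hxm hc hcx
    have ha := (exists_eq_of_isLocalLift_cylinder hC hb hO hc).1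
    have h1 := h i ⟨x, hx.1⟩ _ (congrArg (fun m => m.1.1) hxm) ha (congrArg Prod.fst hcx)
    exact (infinitesimal_cylinder hC hb hO hc (-(C.φ m.1.1))).trans (Prod.ext h1 rfl)

theorem cylinder_isCompatible (hC : C.IsOrbifold) (hb : C.boundary = ∅) (hO : IsOpen U)
    (hφ : C.IsCompatible B) : (C.cylinder U hU).IsCompatible B := by
  obtain ⟨h, hh, K, hK⟩ := hφ
  refine ⟨fun i x => h i.1 x.1, ⟨?_, ?_, ?_⟩, K, ?_⟩
  · exact fun i s t => (hh.smooth i.1 s t).comp contDiff_fst.contDiffOn fun x hx => hx.1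
  · exact fun i x hx => hh.pos i.1 x.1 hx.1
  · rintro g₀ ⟨i, b⟩ ⟨j, b'⟩ ⟨x, s⟩ c A hA
    exact hh.inv g₀ i j x _ _ (isBundleLift_of_cylinder hC hb hO hA)
  · rintro ⟨i, b⟩ ⟨⟨x, s⟩, hx⟩ hm c A hA hcx hA1 ξ hξ
    have hξ' := (infinitesimal_cylinder hC hb hO hA.1 ξ).symm.trans hξ
    exact hK i ⟨x, hx.1⟩ ((mem_cylinder_vanishingSet hC hb hO _).1 hm) _ _
      (isBundleLift_of_cylinder hC hb hO hA) (congrArg Prod.fst hcx) hA1 ξ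
      (congrArg Prod.fst hξ')

/-- The zero set is all of M^φ × [0,1], and projection along the compact interval is proper. -/
theorem isProperMap_cylinder_φ (hC : C.IsOrbifold) (hb : C.boundary = ∅) (hO : IsOpen U)
    (hv : C.vanishingSet ⊆ U) (hprop : IsProperMap (fun m : C.vanishingSet => C.φ m)) :
    IsProperMap (fun m : (C.cylinder U hU).vanishingSet => (C.cylinder U hU).φ m) := by
  let f : (C.cylinder U hU).vanishingSet → C.vanishingSet × Icc (0 : ℝ) 1 := fun m =>
    (⟨m.1.1.1, (mem_cylinder_vanishingSet hC hb hO _).1 m.2⟩,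
      ⟨m.1.1.2, m.1.2.1, m.1.2.2.1⟩)
  have hf : IsClosedEmbedding f := by
    refine ⟨?_, ?_⟩
    · refine IsEmbedding.of_comp (g := Prod.map Subtype.val Subtype.val) ?_ ?_
        (IsEmbedding.subtypeVal.comp IsEmbedding.subtypeVal)
      · refine Continuous.prodMk (Continuous.subtype_mk ?_ _) (Continuous.subtype_mk ?_ _)
        · exact continuous_fst.comp (continuous_subtype_val.comp continuous_subtype_val)
        · exact continuous_snd.comp (continuous_subtype_val.comp continuous_subtype_val)
      · exact continuous_subtype_val.prodMap continuous_subtype_val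
    · convert isClosed_univ
      rw [Set.eq_univ_iff_forall]
      rintro ⟨⟨m, hm⟩, ⟨t, ht0, ht1⟩⟩
      -- This is where M^φ ⊆ U enters: no zero is missing at t = 1.
      exact ⟨⟨⟨(m, t), ht0, ht1, fun _ => hv hm⟩, (mem_cylinder_vanishingSet hC hb hO _).2 hm⟩, rfl⟩
  exact hprop.comp (isProperMap_fst_of_compactSpace.comp hf.isProperMap)

theorem cylinder_isKChain (hC : C.IsKCycle B) (hO : IsOpen U) (hv : C.vanishingSet ⊆ U) :
    (C.cylinder U hU).IsKChain B := by
  obtain ⟨⟨h, hE, hJ, hφ, hprop, hcomp⟩, hb⟩ := hC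
  exact ⟨cylinder_isOrbifold h hb hO, cylinder_isBundle h hb hO hE,
    cylinder_isStableComplex h hb hO hJ, cylinder_isEquivariantMap hφ,
    isProperMap_cylinder_φ h hb hO hv hprop, cylinder_isCompatible h hb hO hcomp⟩

end Cylinder

end GTriple


/-! ### The ends of the cylinder, their orientations, and the bordism. -/

/-- The identification `V ⊕ ℝᵏ⁺² = V ⊕ ℝ ⊕ ℝᵏ⁺¹` by `-1` on the first coordinate of `ℝᵏ⁺²`. -/
def collarEquiv (V : Type*) [NormedAddCommGroup V] [NormedSpace ℝ V] (k : ℕ) :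
    (V × (Fin (k + 2) → ℝ)) ≃L[ℝ] ((V × ℝ) × (Fin (k + 1) → ℝ)) where
  toFun z := ((z.1, -z.2 0), fun s => z.2 s.succ)
  invFun w := (w.1.1, Fin.cons (-w.1.2) w.2)
  map_add' z w := by
    refine Prod.ext (Prod.ext rfl ?_) rfl
    exact neg_add (z.2 0) (w.2 0)
  map_smul' c z := by
    refine Prod.ext (Prod.ext rfl ?_) rfl
    exact (mul_neg c (z.2 0)).symm
  left_inv z := by
    refine Prod.ext rfl (funext fun s => ?_)
    refine Fin.cases ?_ (fun _ => ?_) s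
    · exact neg_neg (z.2 0)
    · rfl
  right_inv w := by
    refine Prod.ext (Prod.ext rfl ?_) rfl
    exact neg_neg w.1.2
  continuous_toFun := by fun_prop
  continuous_invFun := by
    refine Continuous.prodMk (by fun_prop) (continuous_pi fun s => ?_)
    refine Fin.cases ?_ (fun s => ?_) s
    · simp only [Fin.cons_zero]; fun_prop
    · simp only [Fin.cons_succ]; fun_prop

namespace GTriple

/-- Reflecting one axis of the plane conjugates the counterclockwise turn to the clockwise one. -/
theorem collarEquiv_addPlanes_quarterTurn {V : Type} [NormedAddCommGroup V] [NormedSpace ℝ V]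
    {k : ℕ} (J : V × (Fin k → ℝ) →L[ℝ] V × (Fin k → ℝ)) (z : V × (Fin (k + 2 * 1) → ℝ)) :
    collarEquiv V k (addPlanes quarterTurn J 1 z) =
      suspension clockwiseTurn J (collarEquiv V k z) := by
  refine Prod.ext (Prod.ext rfl ?_) (funext fun s => ?_)
  · exact neg_neg (z.2 1)
  · refine Fin.cases ?_ (fun _ => rfl) s
    exact (neg_neg (z.2 0)).symm

theorem collarEquiv_addPlanes_id {V V' : Type} [NormedAddCommGroup V] [NormedSpace ℝ V]
    [NormedAddCommGroup V'] [NormedSpace ℝ V']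
    {k : ℕ} (T : V × (Fin k → ℝ) →L[ℝ] V' × (Fin k → ℝ)) (z : V × (Fin (k + 2 * 1) → ℝ)) :
    collarEquiv V' k (addPlanes id T 1 z) = suspension (.id ℝ _) T (collarEquiv V k z) := by
  refine Prod.ext (Prod.ext rfl rfl) (funext fun s => ?_)
  refine Fin.cases ?_ (fun _ => rfl) s
  rfl

/-- Only the normal coordinate is rescaled, by `-(n.2)⁻¹`, with a correction in V for the tangential
part of `n`. Such a map is x ↦ x + f(x) u, of determinant 1 + f(u); the entry `-(n.2)⁻¹ - 1` of `u`
is chosen accordingly. The sign of the determinant thus records the end of the interval. -/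
theorem exists_collarEquiv_eq_normalSplitting {V : Type} [NormedAddCommGroup V] [NormedSpace ℝ V]
    [FiniteDimensional ℝ V] {k : ℕ} (hr : k + 2 * 1 = (k + 1 + 2 * 0) + 1) (n : V × ℝ)
    (hn : n.2 ≠ 0) :
    ∃ T : (V × (Fin (k + 2 * 1) → ℝ)) →ₗ[ℝ] (V × (Fin (k + 2 * 1) → ℝ)),
      (∀ z, collarEquiv V k z = normalSplitting hr (ContinuousLinearMap.inl ℝ V ℝ) n (T z)) ∧
      LinearMap.det T = -(n.2)⁻¹ := by
  let f : Module.Dual ℝ (V × (Fin (k + 2 * 1) → ℝ)) :=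
    LinearMap.proj 0 ∘ₗ LinearMap.snd ℝ V (Fin (k + 2 * 1) → ℝ)
  let u : V × (Fin (k + 2 * 1) → ℝ) := ((n.2)⁻¹ • n.1, Pi.single 0 (-(n.2)⁻¹ - 1))
  refine ⟨LinearMap.transvection f u, fun z => ?_, ?_⟩
  · have h0 : (LinearMap.transvection f u z).2 0 = -(n.2)⁻¹ * z.2 0 := by
      show z.2 0 + z.2 0 * (Pi.single 0 (-(n.2)⁻¹ - 1) : Fin (k + 2 * 1) → ℝ) 0 = _
      rw [Pi.single_eq_same]
      ring
    have hs : ∀ s : Fin (k + 1), (LinearMap.transvection f u z).2 s.succ = z.2 s.succ := by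
      intro s
      show z.2 s.succ + z.2 0 * (Pi.single 0 (-(n.2)⁻¹ - 1) : Fin (k + 2 * 1) → ℝ) s.succ = _
      rw [Pi.single_eq_of_ne (Fin.succ_ne_zero s), mul_zero, add_zero]
    have hV : (LinearMap.transvection f u z).1 = z.1 + z.2 0 • (n.2)⁻¹ • n.1 := rfl
    refine Prod.ext (Prod.ext ?_ ?_) (funext fun s => (hs s).symm)
    · show z.1 = (LinearMap.transvection f u z).1 + (LinearMap.transvection f u z).2 0 • n.1
      rw [h0, hV, add_assoc, smul_smul, ← add_smul]
      rw [show z.2 0 * (n.2)⁻¹ + -(n.2)⁻¹ * z.2 0 = 0 by ring, zero_smul, add_zero]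
    · show -z.2 0 = 0 + (LinearMap.transvection f u z).2 0 * n.2
      rw [h0]
      field_simp
      ring
  · rw [LinearMap.transvection.det]
    show 1 + (Pi.single 0 (-(n.2)⁻¹ - 1) : Fin (k + 2 * 1) → ℝ) 0 = _
    rw [Pi.single_eq_same]
    ring

section Cylinder

variable {d : ℕ} {G : Type*} [Group G] [TopologicalSpace G]
  [ChartedSpace (EuclideanSpace ℝ (Fin d)) G] {k : ℕ}
  {ρ : G →* ((Fin k → ℝ) →L[ℝ] (Fin k → ℝ))}
  {C : GTriple (d := d) G k ρ} {U : Set C.X} {hU : C.IsInvariant U}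
  {B : GroupLieAlgebra (𝓡 d) G →ₗ[ℝ] GroupLieAlgebra (𝓡 d) G →ₗ[ℝ] ℝ}

theorem cylinder_ℓ_ne_zero (i : C.ι) (b : Bool) : (C.cylinder U hU).ℓ (i, b) ≠ 0 := by
  intro h
  have := congrArg (fun T => T ((0 : C.V i), (1 : ℝ))) h
  cases b <;> simp [inwardSign] at this

theorem cylinder_ℓ_eq_zero_iff {i : C.ι} {b : Bool} {y : C.V i × ℝ} :
    (C.cylinder U hU).ℓ (i, b) y = 0 ↔ y.2 = 0 := by
  show inwardSign b * y.2 = 0 ↔ y.2 = 0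
  cases b <;> simp [inwardSign]

theorem mem_cylinder_boundary (hC : C.IsOrbifold) (m : (C.cylinder U hU).X) :
    m ∈ (C.cylinder U hU).boundary ↔ ∃ b, m.1.2 = endpoint b := by
  constructor
  · rintro ⟨⟨i, b⟩, ⟨⟨x, s⟩, hx⟩, -, h, rfl⟩
    have hs : s = 0 := cylinder_ℓ_eq_zero_iff.1 h
    exact ⟨b, by simp [hs]⟩
  · rintro ⟨b, h⟩
    obtain ⟨⟨m, t⟩, hm⟩ := m
    simp only [] at h
    subst h
    obtain ⟨i, x, rfl⟩ := hC.cover m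
    have hx : (x.1, (0 : ℝ)) ∈ (C.cylinder U hU).dom (i, b) :=
      ⟨x.2, by rw [zero_add]; exact hm, by simp⟩
    exact ⟨(i, b), ⟨_, hx⟩, cylinder_ℓ_ne_zero i b, cylinder_ℓ_eq_zero_iff.2 rfl,
      Subtype.ext (Prod.ext rfl (zero_add _))⟩

/-- The inclusion of an open part of `C` in the end `endpoint b` of the cylinder. -/
def OpenPart.toCylinder (P : OpenPart C) (b : Bool)
    (hP : ∀ m, (P.incl m, endpoint b) ∈ cylinderSet U) (m : P.X) : (C.cylinder U hU).X :=
  ⟨(P.incl m, endpoint b), hP m⟩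

/-- The inclusion of the bundle over an open part of `C` in the bundle over the cylinder. -/
def OpenPart.toCylinderE (P : OpenPart C) (b : Bool)
    (hP : ∀ m, (P.incl m, endpoint b) ∈ cylinderSet U) (e : P.E) : (C.cylinder U hU).E :=
  ⟨(P.inclE e, endpoint b), by rw [← P.incl_p]; exact hP (P.p e)⟩

/-- The image is a full level set of t, hence closed in the cylinder even if the part is not closed
in M. Two disjoint closed embeddings then combine to an embedding of the disjoint union. -/
theorem OpenPart.isClosedEmbedding_toCylinder (P : OpenPart C) (b : Bool)
    (hP : ∀ m, (P.incl m, endpoint b) ∈ cylinderSet U)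
    (hr : ∀ m, (m, endpoint b) ∈ cylinderSet U → m ∈ range P.incl) :
    IsClosedEmbedding (P.toCylinder (hU := hU) b hP) := by
  refine ⟨?_, ?_⟩
  · refine IsEmbedding.of_comp (g := fun m : (C.cylinder U hU).X => m.1.1) ?_ ?_
      P.isOpenEmbedding.isEmbedding
    · exact Continuous.subtype_mk (P.isOpenEmbedding.continuous.prodMk continuous_const) _
    · exact continuous_fst.comp continuous_subtype_val
  · have : range (P.toCylinder (hU := hU) b hP) = {m | m.1.2 = endpoint b} := by
      ext ⟨⟨m, t⟩, hm⟩
      constructor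
      · rintro ⟨m', h⟩
        exact congrArg (fun m => m.1.2) h.symm
      · rintro (rfl : t = endpoint b)
        obtain ⟨m', rfl⟩ := hr m hm
        exact ⟨m', rfl⟩
    rw [this]
    exact isClosed_eq (continuous_snd.comp continuous_subtype_val) continuous_const

theorem OpenPart.isBoundaryPart_cylinder (hC : C.IsOrbifold) (hb : C.boundary = ∅) (hO : IsOpen U)
    (P : OpenPart C) (b : Bool) (hP : ∀ m, (P.incl m, endpoint b) ∈ cylinderSet U) :
    IsBoundaryPart (inwardSign b) P.toTriple (C.cylinder U hU)
      (P.toCylinder b hP) (P.toCylinderE b hP) := by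
  have hs : ∀ (i : P.ι) (x : C.V (P.κ i)), x ∈ P.dom i →
      fderivWithin ℝ (fun x : C.V (P.κ i) => (x, (0 : ℝ))) (P.dom i) x =
        ContinuousLinearMap.inl ℝ (C.V (P.κ i)) ℝ := by
    intro i x hx
    rw [fderivWithin_of_isOpen (P.isOpen_dom hC hb i) hx]
    exact (hasFDerivAt_prodMk_left x (0 : ℝ)).fderiv
  have hxW : ∀ (i : P.ι) (x : P.dom i),
      (x.1, (0 : ℝ)) ∈ (C.cylinder U hU).dom (P.κ i, b) := by
    intro i x
    refine ⟨P.dom_subset i x.2, ?_, by simp⟩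
    have := hP (P.π i x)
    rw [P.incl_π] at this
    rwa [zero_add]
  refine ⟨fun g m => Subtype.ext (Prod.ext (P.incl_smul g m) rfl), fun m => rfl,
    fun g e => Subtype.ext (Prod.ext (P.inclE_smul g e) rfl),
    fun e => Subtype.ext (Prod.ext (P.incl_p e).symm rfl),
    fun i => (P.κ i, b), fun i x => (x, 0), fun i _ => .id ℂ _,
    fun i => (contDiff_id.prodMk contDiff_const).contDiffOn, fun i => contDiffOn_const, ?_,
    -- One copy of ℂ is added to the part and none to the cylinder, whose trivial summand is already
    -- larger by one; the normal line accounts for the remaining dimension.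
    1, 0, by ring, fun i _ => (collarEquiv (C.V (P.κ i)) k : _ →L[ℝ] _),
    fun i => contDiffOn_const, fun i x hx => (collarEquiv (C.V (P.κ i)) k).bijective,
    fun i x hx z => collarEquiv_addPlanes_quarterTurn _ z, ?_, ?_⟩
  · intro i x
    have h := hs i x x.2
    refine ⟨cylinder_ℓ_ne_zero _ _, cylinder_ℓ_eq_zero_iff.2 rfl, ?_, ?_, Function.bijective_id,
      hxW i x, ?_, ?_⟩
    · show Function.Injective (fderivWithin ℝ (fun x : C.V (P.κ i) => (x, (0 : ℝ))) (P.dom i) x)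
      rw [h]
      exact fun y y' hy => congrArg Prod.fst hy
    · show range (fderivWithin ℝ (fun x : C.V (P.κ i) => (x, (0 : ℝ))) (P.dom i) x) = _
      rw [h]
      ext y
      refine Iff.trans ?_ cylinder_ℓ_eq_zero_iff.symm
      constructor
      · rintro ⟨v, rfl⟩
        rfl
      · intro hy
        exact ⟨y.1, Prod.ext rfl hy.symm⟩
    · exact Subtype.ext (Prod.ext (P.incl_π i x).symm (zero_add _))
    · exact fun v => Subtype.ext (Prod.ext (P.inclE_triv i x v).symm (zero_add _))
  · intro g₀ i j x a c ha hc hac z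
    have h1 := tangentMap_cylinder hC hb hO hc
    -- On the slice t = 0 of the chart, the lift `c` restricts to `a`, so both have the same
    -- tangential derivative.
    have h2 : C.tangentMap (i := P.κ i) (j := P.κ j) (fun g y => (c g (y, 0)).1) g₀ x =
        C.tangentMap (i := P.κ i) (j := P.κ j) a g₀ x := by
      have h3 : ∀ᶠ y in 𝓝[P.dom i] x, c g₀ (y, 0) = (a g₀ y, 0) := hac.curry.self_of_nhds
      rw [(P.isOpen_dom hC hb i).nhdsWithin_eq ha.1,
        ← (hC.isOpen_dom hb _).nhdsWithin_eq (P.dom_subset i ha.1)] at h3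
      have h4 : (fun y => (c g₀ (y, 0)).1) =ᶠ[𝓝[C.dom (P.κ i)] x] a g₀ :=
        h3.mono fun y hy => congrArg Prod.fst hy
      exact h4.fderivWithin_eq (h4.self_of_nhdsWithin (P.dom_subset i ha.1))
    rw [P.tangentMap_eq hC hb ha.1, h1, h2]
    exact collarEquiv_addPlanes_id _ z
  · intro i x hx n hn
    have hn' : inwardSign b * n.2 < 0 := hn
    have hn0 : n.2 ≠ 0 := by
      intro h
      rw [h, mul_zero] at hn'
      exact lt_irrefl _ hn'
    obtain ⟨T, hT, hdet⟩ := exists_collarEquiv_eq_normalSplitting (by ring) n hn0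
    refine ⟨T, fun z => ?_, ?_⟩
    · have h := hs i x hx
      show _ = normalSplitting _
        (fderivWithin ℝ (fun x : C.V (P.κ i) => (x, (0 : ℝ))) (P.dom i) x) n (T z)
      rw [h]
      exact hT z
    · rw [hdet]
      -- An outward vector has `n.2 < 0` at t = 0 and `n.2 > 0` at t = 1, so the determinant
      -- `-(n.2)⁻¹` is positive at the first end and negative at the second.
      cases b
      · simp only [inwardSign, Bool.false_eq_true, if_false, one_mul] at hn' ⊢
        exact neg_pos.2 (inv_lt_zero.2 hn')
      · simp only [inwardSign, if_true] at hn' ⊢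
        have : 0 < n.2 := by linarith
        have := inv_pos.2 this
        linarith

/-- A `K`-cycle is bordant to each open part that contains the zeros of `V^φ`. -/
theorem OpenPart.bordant (hC : C.IsKCycle B) (P : OpenPart C)
    (hinv : C.IsInvariant (range P.incl)) (hv : C.vanishingSet ⊆ range P.incl) :
    Bordant B C P.toTriple := by
  have hO := P.isOpenEmbedding.isOpen_range
  have h0 : ∀ m, (C.wholePart.incl m, endpoint false) ∈ cylinderSet (range P.incl) := fun m =>
    ⟨le_rfl, zero_le_one, fun h => absurd h zero_ne_one⟩
  have h1 : ∀ m, (P.incl m, endpoint true) ∈ cylinderSet (range P.incl) := fun m =>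
    ⟨zero_le_one, le_rfl, fun _ => ⟨m, rfl⟩⟩
  have hf := C.wholePart.isClosedEmbedding_toCylinder (hU := hinv) false h0 fun m _ => ⟨m, rfl⟩
  have hf' := P.isClosedEmbedding_toCylinder (hU := hinv) true h1 fun m hm => hm.2.2 rfl
  refine ⟨k + 1, trivialExtension ρ, C.cylinder (range P.incl) hinv, cylinder_isKChain hC hO hv,
    C.wholePart.toCylinder false h0, C.wholePart.toCylinderE false h0,
    P.toCylinder true h1, P.toCylinderE true h1, ?_, ?_, ?_, ?_⟩
  · exact C.wholePart.isBoundaryPart_cylinder hC.chain.orbifold hC.boundaryless hO false h0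
  · exact P.isBoundaryPart_cylinder hC.chain.orbifold hC.boundaryless hO true h1
  · refine (hf.sumElim hf' ?_).isEmbedding
    refine hf.injective.sumElim hf'.injective fun m m' h => ?_
    have : (0 : ℝ) = 1 := congrArg (fun m => m.1.2) h
    exact zero_ne_one this
  · ext m
    rw [mem_cylinder_boundary hC.chain.orbifold]
    constructor
    · rintro ⟨m' | m', rfl⟩
      · exact ⟨false, rfl⟩
      · exact ⟨true, rfl⟩
    · obtain ⟨⟨m, t⟩, hm⟩ := m
      rintro ⟨b, rfl : t = endpoint b⟩
      cases b
      · exact ⟨Sum.inl m, rfl⟩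
      · obtain ⟨m', rfl⟩ := hm.2.2 rfl
        exact ⟨Sum.inr m', rfl⟩

end Cylinder

/-! ### Localization and gluing. -/

section Localization

variable {d : ℕ} {G : Type*} [Group G] [TopologicalSpace G]
  [ChartedSpace (EuclideanSpace ℝ (Fin d)) G] {k : ℕ}
  {ρ : G →* ((Fin k → ℝ) →L[ℝ] (Fin k → ℝ))}
  {C : GTriple (d := d) G k ρ}
  {B : GroupLieAlgebra (𝓡 d) G →ₗ[ℝ] GroupLieAlgebra (𝓡 d) G →ₗ[ℝ] ℝ}

theorem localization (hC : C.IsKCycle B) {A : Type} {U : A → Set C.X}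
    (hU : ∀ α, C.IsInvariant (U α)) (hO : ∀ α, IsOpen (U α))
    (hd : Pairwise fun α β => Disjoint (U α) (U β)) (hv : C.vanishingSet ⊆ ⋃ α, U α) :
    (∀ α, (C.restrict (U α) (hU α)).IsKCycle B) ∧
    (disjointUnion fun α => C.restrict (U α) (hU α)).IsKCycle B ∧
    Bordant B C (disjointUnion fun α => C.restrict (U α) (hU α)) := by
  have hr : range (C.disjointUnionPart U hU hO hd).incl = ⋃ α, U α := by
    ext m
    rw [mem_iUnion]
    constructor
    · rintro ⟨⟨α, m, hm⟩, rfl⟩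
      exact ⟨α, hm⟩
    · rintro ⟨α, hm⟩
      exact ⟨⟨α, m, hm⟩, rfl⟩
  refine ⟨fun α => (C.restrictPart (U α) (hU α) (hO α)).isKCycle hC ?_,
    (C.disjointUnionPart U hU hO hd).isKCycle hC ?_,
    (C.disjointUnionPart U hU hO hd).bordant hC ?_ ?_⟩
  · show IsClosed ((↑) ⁻¹' range (Subtype.val : U α → C.X) : Set C.vanishingSet)
    rw [Subtype.range_coe]
    -- Inside M^φ the sets U_β form a partition into open sets, so each of them is also closed
    -- there.
    have : ((↑) ⁻¹' U α : Set C.vanishingSet) = ((↑) ⁻¹' ⋃ β ≠ α, U β : Set C.vanishingSet)ᶜ := by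
      ext ⟨m, hm⟩
      simp only [mem_preimage, mem_compl_iff, mem_iUnion, not_exists]
      constructor
      · intro h β hβ h'
        exact Set.disjoint_left.1 (hd hβ) h' h
      · intro h
        obtain ⟨β, hβ⟩ := mem_iUnion.1 (hv hm)
        by_cases h' : β = α
        · exact h' ▸ hβ
        · exact absurd hβ (h β h')
    rw [this]
    exact ((isOpen_biUnion fun β _ => hO β).preimage continuous_subtype_val).isClosed_compl
  · rw [hr]
    convert isClosed_univ
    exact Set.eq_univ_of_forall fun m => hv m.2
  · rw [hr]
    intro g m hm
    obtain ⟨α, hα⟩ := mem_iUnion.1 hm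
    exact mem_iUnion.2 ⟨α, hU α g m hα⟩
  · rw [hr]
    exact hv

/-- Continuity of the action is not part of the data of a triple; it is recovered from the smooth
local lifts in charts. -/
theorem IsOrbifold.continuous_orbitMap (hC : C.IsOrbifold) (m : C.X) :
    Continuous fun g : G => g • m := by
  rw [continuous_iff_continuousAt]
  intro g₀
  obtain ⟨i, x, rfl⟩ := hC.cover m
  obtain ⟨j, y, hy⟩ := hC.cover (g₀ • C.π i x)
  obtain ⟨a, ⟨hx, ha⟩, hax⟩ := hC.lift g₀ i j x y hy.symm
  have h1 : Tendsto (fun g : G => (g, (x : C.V i))) (𝓝 g₀) (𝓝 g₀ ×ˢ 𝓝[C.dom i] (x : C.V i)) :=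
    tendsto_id.prodMk (tendsto_const_pure.mono_right (pure_le_nhdsWithin hx))
  have h2 := h1.eventually ha
  have h3 : ContinuousAt (fun g => a g x) g₀ := by
    have := h2.self_of_nhds.2.1.continuousWithinAt
    exact ContinuousWithinAt.tendsto this |>.comp (tendsto_nhdsWithin_iff.2
      ⟨Continuous.tendsto (by fun_prop : Continuous fun g : G => (g, (x : C.V i))) g₀,
        Eventually.of_forall fun g => ⟨trivial, hx⟩⟩)
  obtain ⟨N, hN, hNa⟩ := eventually_iff_exists_mem.1 h2
  have h4 : ContinuousAt (fun g : N => C.π j ⟨a g x, (hNa g g.2).1.2.1⟩)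
      ⟨g₀, mem_of_mem_nhds hN⟩ := by
    refine (hC.continuous j).continuousAt.comp ?_
    rw [Topology.IsInducing.subtypeVal.continuousAt_iff]
    exact ContinuousAt.comp (g := fun g => a g x) h3 continuous_subtype_val.continuousAt
  have h5 : (fun g : N => C.π j ⟨a g x, (hNa g g.2).1.2.1⟩) = fun g : N => (g : G) • C.π i x :=
    funext fun g => (hNa g g.2).1.2.2
  rw [h5] at h4
  have h6 : ContinuousWithinAt (fun g => g • C.π i x) N g₀ :=
    (continuousWithinAt_iff_continuousAt_domRestrict _ (mem_of_mem_nhds hN)).2 h4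
  exact h6.continuousAt hN

/-- The orbit of a point off `S` avoids `S` and is connected, so it cannot pass from one open side
to the other. -/
theorem isInvariant_of_union_eq_compl [ConnectedSpace G] (hC : C.IsOrbifold) {S M M' : Set C.X}
    (hS : C.IsInvariant S) (hM : IsOpen M) (hM' : IsOpen M') (hd : Disjoint M M')
    (hu : M ∪ M' = Sᶜ) : C.IsInvariant M := by
  intro g m hm
  have hcont := hC.continuous_orbitMap m
  have hpre : IsPreconnected (range fun g : G => g • m) := isPreconnected_range hcont
  have hsub : (range fun g : G => g • m) ⊆ M ∪ M' := by
    rw [hu]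
    rintro _ ⟨g, rfl⟩ h
    have hmS : m ∈ Sᶜ := hu ▸ Or.inl hm
    refine hmS ?_
    have := hS g⁻¹ _ h
    rwa [inv_smul_smul] at this
  exact hpre.subset_left_of_subset_union hM hM' hd hsub ⟨m, ⟨1, one_smul G m⟩, hm⟩ ⟨g, rfl⟩

/-- Localization to the two sides, which cover M^φ because V^φ has no zero on `S`. -/
theorem gluing [ConnectedSpace G] (hC : C.IsKCycle B) {S Mp Mm : Set C.X} (hS : C.IsInvariant S)
    (hMp : IsOpen Mp) (hMm : IsOpen Mm) (hd : Disjoint Mp Mm) (hu : Mp ∪ Mm = Sᶜ)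
    (hv : Disjoint S C.vanishingSet) :
    ∃ (hp : C.IsInvariant Mp) (hm : C.IsInvariant Mm),
      (C.restrict Mp hp).IsKCycle B ∧ (C.restrict Mm hm).IsKCycle B ∧
      (add (C.restrict Mp hp) (C.restrict Mm hm)).IsKCycle B ∧
      Bordant B C (add (C.restrict Mp hp) (C.restrict Mm hm)) := by
  have hp := isInvariant_of_union_eq_compl hC.chain.orbifold hS hMp hMm hd hu
  have hm := isInvariant_of_union_eq_compl hC.chain.orbifold hS hMm hMp hd.symm
    (by rw [union_comm, hu])
  let U : Bool → Set C.X := fun b => match b with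
    | true => Mp
    | false => Mm
  have hU : ∀ b, C.IsInvariant (U b) := fun b => match b with
    | true => hp
    | false => hm
  -- The sum selects a triple by a Boolean, the localized union restricts to a set selected by a
  -- Boolean; they agree after splitting into cases.
  have hadd : add (C.restrict Mp hp) (C.restrict Mm hm) =
      disjointUnion fun b => C.restrict (U b) (hU b) := by
    unfold add
    congr 1
    funext b
    cases b <;> rfl
  have h := localization hC hU (fun b => match b with
    | true => hMp
    | false => hMm) (by
      rintro (_ | _) (_ | _) hne
      · exact absurd rfl hne
      · exact hd.symm
      · exact hd
      · exact absurd rfl hne) (by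
      intro x hx
      have : x ∈ Mp ∪ Mm := hu ▸ fun hxS => Set.disjoint_left.1 hv hxS hx
      exact mem_iUnion.2 (this.elim (fun h => ⟨true, h⟩) fun h => ⟨false, h⟩))
  refine ⟨hp, hm, h.1 true, h.1 false, ?_⟩
  rw [hadd]
  exact h.2

end Localization

end GTriple

end

theorem mainTheorem8 {d : ℕ} {G : Type*} [Group G] [TopologicalSpace G]
    [ChartedSpace (EuclideanSpace ℝ (Fin d)) G] [LieGroup (𝓡 d) ∞ G]
    [T2Space G] [CompactSpace G] [ConnectedSpace G]
    (B : GroupLieAlgebra (𝓡 d) G →ₗ[ℝ] GroupLieAlgebra (𝓡 d) G →ₗ[ℝ] ℝ)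
    (hB : IsInvariantInner B)
    {k : ℕ} {ρ : G →* ((Fin k → ℝ) →L[ℝ] (Fin k → ℝ))}
    (C : GTriple (d := d) G k ρ) (hC : C.IsKCycle B) :
    (∀ (A : Type) (U : A → Set C.X) (hinv : ∀ α, C.IsInvariant (U α)),
      (∀ α, IsOpen (U α)) → Pairwise (fun α β => Disjoint (U α) (U β)) →
      C.vanishingSet ⊆ ⋃ α, U α →
      (∀ α, (C.restrict (U α) (hinv α)).IsKCycle B) ∧
      (GTriple.disjointUnion (fun α => C.restrict (U α) (hinv α))).IsKCycle B ∧
      GTriple.Bordant B C (GTriple.disjointUnion (fun α => C.restrict (U α) (hinv α)))) ∧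
    (∀ S Mp Mm : Set C.X, C.IsHypersurface S → C.IsInvariant S →
      IsOpen Mp → IsOpen Mm → Disjoint Mp Mm → Mp ∪ Mm = Sᶜ →
      Disjoint S C.vanishingSet →
      ∃ (hp : C.IsInvariant Mp) (hm : C.IsInvariant Mm),
        (C.restrict Mp hp).IsKCycle B ∧ (C.restrict Mm hm).IsKCycle B ∧
        (GTriple.add (C.restrict Mp hp) (C.restrict Mm hm)).IsKCycle B ∧
        GTriple.Bordant B C (GTriple.add (C.restrict Mp hp) (C.restrict Mm hm))) := by
  refine ⟨fun A U hU hO hd hv => GTriple.localization hC hU hO hd hv, ?_⟩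
  intro S Mp Mm _ hS hMp hMm hd hu hv
  exact GTriple.gluing hC hS hMp hMm hd hu hv
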